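/- Let $n\ge 1$ and identify $\mathbb R^{2n}$ with $\mathbb C^n$, with Hermitian inner product $\langle z,w\rangle=\sum_j \bar z_j w_j$ and symplectic form $\omega(z,w)=\operatorname{Im}\langle z,w\rangle$. For $\mu\in\mathbb C$ and $\delta\in\mathbb Z/2\mathbb Z$ let $$V_{\mu,\delta}^\infty=\{f\in C^\infty(\mathbb R^{2n}\setminus\{0\}): f(rx)=(\operatorname{sgn} r)^\delta|r|^{-n-\mu}f(x),\ r\in\mathbb R^\times\}$$ be the space of smooth vectors of the degenerate principal series representation $\pi_{\mu,\delta}$ of $Sp(n,\mathbb R)$. The Knapp–Stein operator $\mathcal T_{\mu,\delta}$ on $V_{-\mu,\delta}^\infty$ is defined, for a fixed restriction of $f$ to the unit sphere $S^{2n-1}$, as the meromorphic continuation in $\mu$, from the half plane $\operatorname{Re}\mu<1-n$ to $\mathbb C$, of $$(\mathcal T_{\mu,\delta}f)(\eta)=\int_{S^{2n-1}}f(\xi)\,|\omega(\xi,\eta)|^{-\mu-n}(\operatorname{sgn}\omega(\xi,\eta))^\delta\,d\sigma(\xi)\qquad(\eta\neq0),$$ where $\sigma$ is the Euclidean surface measure.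 The normalized operator is $\widetilde{\mathcal T}_{\mu,\delta}=C_{2n}(\mu,\delta)^{-1}\mathcal T_{\mu,\delta}$, the quotient being one of meromorphic functions of $\mu$, with $$C_{2n}(\mu,0)=2\pi^{\mu+n-\frac12}\,\frac{\Gamma(\frac{1-\mu-n}2)}{\Gamma(\frac{\mu+n}2)},\qquad C_{2n}(\mu,1)=-2i\,\pi^{\mu+n-\frac12}\,\frac{\Gamma(\frac{2-\mu-n}2)}{\Gamma(\frac{\mu+n+1}2)}.$$ For $\alpha,\beta\in\mathbb N=\{0,1,2,\dots\}$ let $\mathcal H^{\alpha,\beta}(\mathbb C^n)$ be the space of polynomials in $z,\bar z$ that are homogeneous of degree $\alpha$ in $z$ and of degree $\beta$ in $\bar z$ and are annihilated by $\sum_i\partial^2/\partial z_i\partial\bar z_i$. Let $\delta\equiv\alpha+\beta \bmod 2$. For each $\mu$, embed $\mathcal H^{\alpha,\beta}(\mathbb C^n)$ into $V_{\mu,\delta}^\infty$ by $p\mapsto p_\mu$, where $p_\mu$ is the homogeneous function of degree $-n-\mu$ that coincides with $p$ on $S^{2n-1}$. **Proposition.** Let $p\in\mathcal H^{\alpha,\beta}(\mathbb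 C^n)$. The meromorphic continuation defining $\mathcal T_{\mu,\delta}$ on $p$ exists at every $\eta\ne0$. For every $\mu\in\mathbb C$ with $\alpha+\beta+\mu+n\notin\{0,-2,-4,\dots\}$, the normalized operator $\widetilde{\mathcal T}_{\mu,\delta}$ acts on the $K$-type $\mathcal H^{\alpha,\beta}(\mathbb C^n)$ as a scalar: $$\widetilde{\mathcal T}_{\mu,\delta}\,p_{-\mu}=(-1)^\beta\,\pi^{-\mu}\,\frac{\Gamma\left(\frac{\alpha+\beta+\mu+n}2\right)}{\Gamma\left(\frac{\alpha+\beta-\mu+n}2\right)}\;p_\mu ,$$ where $1/\Gamma$ is understood as an entire function. -/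

import Mathlib

open MeasureTheory Metric Set
open scoped ContDiff

noncomputable section

namespace KnappStein

/-- The space `ℂⁿ`, with its standard Hermitian inner product. Its underlying real Euclidean space
is `ℝ²ⁿ`. -/
abbrev Cn (n : ℕ) : Type := EuclideanSpace ℂ (Fin n)

/-- The symplectic form on `ℝ²ⁿ = ℂⁿ`: the imaginary part of the Hermitian inner product
`⟨z, w⟩ = ∑ conj (z j) * w j`. -/
def symplecticForm (n : ℕ) (z w : Cn n) : ℝ := (inner ℂ z w : ℂ).im

/-- In the real coordinates `z = ξ + i x`, `w = η + i y`, the symplectic form is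
`⟨ξ, y⟩ - ⟨x, η⟩`. -/
theorem symplecticForm_eq (n : ℕ) (z w : Cn n) :
    symplecticForm n z w
      = (∑ j, (z j).re * (w j).im) - ∑ j, (z j).im * (w j).re := by
  simp only [symplecticForm, PiLp.inner_apply, Complex.im_sum, ← Finset.sum_sub_distrib]
  refine Finset.sum_congr rfl fun j _ => ?_
  simp only [RCLike.inner_apply, Complex.mul_im, Complex.conj_re, Complex.conj_im]
  ring

/-- `(sgn t) ^ δ` for `δ ∈ ℤ/2ℤ`. -/
def sgnPow (t : ℝ) (δ : ZMod 2) : ℂ := (((SignType.sign t : SignType) : ℝ) : ℂ) ^ δ.val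

/-! ### The smooth degenerate principal series -/

/-- The space `V_{μ,δ}^∞` of smooth functions `f` on `ℝ²ⁿ ∖ {0}` such that
`f (r x) = (sgn r)^δ |r|^{-n-μ} f x` for all real `r ≠ 0`. A function on `ℝ²ⁿ ∖ {0}` is represented
by its extension by the value `0` at the origin. -/
def principalSeries (n : ℕ) (μ : ℂ) (δ : ZMod 2) : Submodule ℂ (Cn n → ℂ) where
  carrier := {f | f 0 = 0 ∧ ContDiffOn ℝ ∞ f {0}ᶜ ∧
    ∀ r : ℝ, r ≠ 0 → ∀ x : Cn n, x ≠ 0 →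
      f (r • x) = sgnPow r δ * ((|r| : ℝ) : ℂ) ^ (-(n : ℂ) - μ) * f x}
  add_mem' := by
    rintro f g ⟨hf0, hf, hf'⟩ ⟨hg0, hg, hg'⟩
    refine ⟨by simp [hf0, hg0], hf.add hg, fun r hr x hx => ?_⟩
    simp only [Pi.add_apply, hf' r hr x hx, hg' r hr x hx]
    ring
  zero_mem' := ⟨rfl, contDiffOn_const, by simp⟩
  smul_mem' := by
    rintro c f ⟨hf0, hf, hf'⟩
    refine ⟨by simp [hf0], contDiffOn_const.smul hf, fun r hr x hx => ?_⟩
    simp only [Pi.smul_apply, smul_eq_mul, hf' r hr x hx]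
    ring

/-! ### Complex spherical harmonics -/

/-- The operator `∑ ∂² / ∂z_i ∂z̄_i` on polynomials in `z_i` (the variables `Sum.inl i`) and `z̄_i`
(the variables `Sum.inr i`). -/
def complexLaplacian (n : ℕ) :
    MvPolynomial (Fin n ⊕ Fin n) ℂ →ₗ[ℂ] MvPolynomial (Fin n ⊕ Fin n) ℂ :=
  ∑ i : Fin n, (MvPolynomial.pderiv (R := ℂ) (Sum.inl i : Fin n ⊕ Fin n)).toLinearMap ∘ₗ
    (MvPolynomial.pderiv (R := ℂ) (Sum.inr i : Fin n ⊕ Fin n)).toLinearMap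

/-- The space `ℋ^{α,β}(ℂⁿ)`: polynomials homogeneous of degree `α` in the `z_i`, homogeneous of
degree `β` in the `z̄_i`, and annihilated by `∑ ∂² / ∂z_i ∂z̄_i`. -/
def harmonics (n α β : ℕ) : Submodule ℂ (MvPolynomial (Fin n ⊕ Fin n) ℂ) :=
  MvPolynomial.weightedHomogeneousSubmodule ℂ (Sum.elim (fun _ => 1) (fun _ => 0)) α ⊓
    MvPolynomial.weightedHomogeneousSubmodule ℂ (Sum.elim (fun _ => 0) (fun _ => 1)) β ⊓
    LinearMap.ker (complexLaplacian n)

/-- The value `p (z, z̄)`. -/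
def evalAt {n : ℕ} (p : MvPolynomial (Fin n ⊕ Fin n) ℂ) (z : Cn n) : ℂ :=
  MvPolynomial.eval (Sum.elim (fun i => z i) (fun i => starRingEnd ℂ (z i))) p

/-- The homogeneous function of degree `-n-μ` on `ℝ²ⁿ ∖ {0}` which coincides with `p` on the unit
sphere (with the value `0` at the origin). -/
def homExt (n : ℕ) (μ : ℂ) (p : MvPolynomial (Fin n ⊕ Fin n) ℂ) (x : Cn n) : ℂ :=
  if x = 0 then 0 else (‖x‖ : ℂ) ^ (-(n : ℂ) - μ) * evalAt p ((‖x‖⁻¹ : ℝ) • x)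

theorem evalAt_smul {n α β : ℕ} {p : MvPolynomial (Fin n ⊕ Fin n) ℂ} (hp : p ∈ harmonics n α β)
    (r : ℝ) (z : Cn n) : evalAt p (r • z) = (r : ℂ) ^ (α + β) * evalAt p z := by
  obtain ⟨⟨h1, h2⟩, -⟩ := hp
  simp only [evalAt, MvPolynomial.eval_eq', Finset.mul_sum]
  refine Finset.sum_congr rfl fun d hd => ?_
  rw [MvPolynomial.mem_support_iff] at hd
  have e1 := h1 hd
  have e2 := h2 hd
  simp only [Finsupp.weight_apply, Finsupp.sum_fintype, Fintype.sum_sum_type, Sum.elim_inl,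
    Sum.elim_inr, smul_eq_mul, mul_one, mul_zero, Finset.sum_const_zero, add_zero, zero_add,
    zero_mul, implies_true] at e1 e2
  simp only [Fintype.prod_sum_type, Sum.elim_inl, Sum.elim_inr, PiLp.smul_apply,
    Complex.real_smul, map_mul, Complex.conj_ofReal, mul_pow, Finset.prod_mul_distrib,
    Finset.prod_pow_eq_pow_sum, e1, e2]
  ring

theorem contDiff_evalAt {n : ℕ} (p : MvPolynomial (Fin n ⊕ Fin n) ℂ) :
    ContDiff ℝ ∞ (evalAt p) := by
  have hc : ∀ i : Fin n, ContDiff ℝ ∞ (fun z : Cn n => z i) := fun i =>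
    ((EuclideanSpace.proj (𝕜 := ℂ) i).restrictScalars ℝ).contDiff
  have e : evalAt p = fun z : Cn n => ∑ d ∈ p.support,
      p.coeff d * ∏ i, (Sum.elim (fun i => z i) (fun i => starRingEnd ℂ (z i)) i) ^ d i := by
    funext z
    simp only [evalAt, MvPolynomial.eval_eq']
  rw [e]
  refine ContDiff.sum fun d _ => contDiff_const.mul (contDiff_prod fun i _ => ContDiff.pow ?_ _)
  rcases i with i | i
  · exact hc i
  · exact Complex.conjCLE.contDiff.comp (hc i)

theorem homExt_mem {n α β : ℕ} (μ : ℂ) {p : MvPolynomial (Fin n ⊕ Fin n) ℂ}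
    (hp : p ∈ harmonics n α β) :
    homExt n μ p ∈ principalSeries n μ ((α + β : ℕ) : ZMod 2) := by
  refine ⟨by simp [homExt], ?_, ?_⟩
  · have h : ContDiffOn ℝ ∞ (fun x : Cn n =>
        Complex.exp (((Real.log ‖x‖ : ℝ) : ℂ) * (-(n : ℂ) - μ)) * evalAt p ((‖x‖⁻¹ : ℝ) • x))
        {0}ᶜ := by
      intro x hx
      have hx0 : x ≠ 0 := hx
      have hn : ContDiffAt ℝ ∞ (fun x : Cn n => ‖x‖) x := contDiffAt_norm ℝ hx0
      refine ContDiffAt.contDiffWithinAt (ContDiffAt.mul ?_ ?_)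
      · exact ((Complex.ofRealCLM.contDiff.contDiffAt.comp x
          (hn.log (norm_ne_zero_iff.2 hx0))).mul contDiffAt_const).cexp
      · exact (contDiff_evalAt p).contDiffAt.comp x
          ((hn.inv (norm_ne_zero_iff.2 hx0)).smul contDiffAt_id)
    refine h.congr fun x hx => ?_
    have hx0 : x ≠ 0 := hx
    have hx1 : (‖x‖ : ℂ) ≠ 0 := by exact_mod_cast norm_ne_zero_iff.2 hx0
    simp only [homExt, hx0, if_false, Complex.cpow_def_of_ne_zero hx1,
      Complex.ofReal_log (norm_nonneg x)]
  · intro r hr x hx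
    have hrx : r • x ≠ 0 := smul_ne_zero hr hx
    have hk : sgnPow r ((α + β : ℕ) : ZMod 2) = ((r / |r| : ℝ) : ℂ) ^ (α + β) := by
      rw [sgnPow, ZMod.val_natCast]
      rcases lt_or_gt_of_ne hr with h | h
      · rw [sign_neg h, abs_of_neg h, div_neg, div_self hr]
        simp [neg_one_pow_eq_pow_mod_two (n := α + β)]
      · rw [sign_pos h, abs_of_pos h, div_self hr]
        simp
    have hs : (‖r • x‖⁻¹ : ℝ) • r • x = (r / |r| : ℝ) • (‖x‖⁻¹ : ℝ) • x := by
      rw [smul_smul, smul_smul, norm_smul, Real.norm_eq_abs]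
      congr 1
      rw [mul_inv]
      ring
    simp only [homExt, hrx, hx, if_false, hs, evalAt_smul hp (r / |r|), hk]
    rw [norm_smul, Real.norm_eq_abs, Complex.ofReal_mul,
      Complex.mul_cpow_ofReal_nonneg (abs_nonneg r) (norm_nonneg x)]
    ring

/-- The embedding of the `K`-type `ℋ^{α,β}(ℂⁿ)` into `V_{μ,δ}^∞`, where `δ ≡ α + β mod 2`: a
polynomial is restricted to the unit sphere and then extended to a homogeneous function. -/
def kType (n : ℕ) (μ : ℂ) (α β : ℕ) :
    harmonics n α β →ₗ[ℂ] principalSeries n μ ((α + β : ℕ) : ZMod 2) where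
  toFun p := ⟨homExt n μ p.1, homExt_mem μ p.2⟩
  map_add' p q := by
    ext x
    by_cases hx : x = 0 <;> simp [homExt, evalAt, hx, mul_add]
  map_smul' c p := by
    ext x
    by_cases hx : x = 0 <;> simp [homExt, evalAt, hx, MvPolynomial.smul_eval, mul_left_comm]

/-! ### The Knapp–Stein operator -/

/-- The integral `∫_{S²ⁿ⁻¹} f ξ |ω(ξ, η)|^{-μ-n} (sgn ω(ξ, η))^δ dσ ξ`, where `σ` is the Euclidean
surface measure on the unit sphere. -/
def knappSteinIntegral (n : ℕ) (μ : ℂ) (δ : ZMod 2) (f : Cn n → ℂ) (η : Cn n) : ℂ :=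
  ∫ ξ : sphere (0 : Cn n) 1,
    f ξ * ((|symplecticForm n ξ η| : ℝ) : ℂ) ^ (-μ - (n : ℂ)) * sgnPow (symplecticForm n ξ η) δ
    ∂(volume : Measure (Cn n)).toSphere

/-- The half plane on which the integral converges absolutely for all continuous `f` and all
`η ≠ 0`. -/
def convergenceDomain (n : ℕ) : Set ℂ := {μ | μ.re < 1 - n}

/-- `F` is the meromorphic continuation to `ℂ` of the restriction of `g` to `U` (normalized to take
the value `0` at its poles, which makes it unique when `U` is open and nonempty). -/
def IsMeromorphicContinuation (g : ℂ → ℂ) (U : Set ℂ) (F : ℂ → ℂ) : Prop :=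
  MeromorphicNFOn F univ ∧ EqOn F g U

open Classical in
/-- The meromorphic continuation to `ℂ` of the restriction of `g` to `U` (`0` if there is none). -/
def meromorphicContinuation (g : ℂ → ℂ) (U : Set ℂ) : ℂ → ℂ :=
  if h : ∃ F, IsMeromorphicContinuation g U F then h.choose else 0

/-- The Knapp–Stein operator: `(𝒯_{μ,δ} f)(η)` is the value at `μ` of the meromorphic continuation
of the integral, for a fixed restriction of `f` to the unit sphere. -/
def knappStein (n : ℕ) (μ : ℂ) (δ : ZMod 2) (f : Cn n → ℂ) (η : Cn n) : ℂ :=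
  if η = 0 then 0
  else meromorphicContinuation (fun ν => knappSteinIntegral n ν δ f η) (convergenceDomain n) μ

/-- The normalizing factor `C_{2n}(μ, δ)`. -/
def normalization (n : ℕ) (μ : ℂ) (δ : ZMod 2) : ℂ :=
  2 * (Real.pi : ℂ) ^ (μ + n - 1 / 2) *
    if δ = 0 then
      Complex.Gamma ((1 - μ - n) / 2) / Complex.Gamma ((μ + n) / 2)
    else
      -Complex.I * (Complex.Gamma ((2 - μ - n) / 2) / Complex.Gamma ((μ + n + 1) / 2))

/-- The normalized Knapp–Stein operator `C_{2n}(μ, δ)⁻¹ 𝒯_{μ,δ}` on `V_{-μ,δ}^∞`. The quotient is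
taken as a quotient of meromorphic functions of the parameter, so removable singularities are
removed. -/
def normalizedKnappStein (n : ℕ) (μ : ℂ) (δ : ZMod 2) (f : principalSeries n (-μ) δ) :
    Cn n → ℂ := fun η =>
  toMeromorphicNFOn (fun ν => (normalization n ν δ)⁻¹ * knappStein n ν δ f η) univ μ

end KnappStein

end

open MeasureTheory Metric Set
open scoped ContDiff

noncomputable section

namespace KnappStein

/-! ### Signed powers of a real variable -/

/-! Put `s = -μ - n` and `k = α + β`. The sphere integral of `p` is read off from the Gaussian
integral over `ℂⁿ` of `q(x) |ω(x, η)|^s (sgn ω(x, η))^δ exp(-‖x‖²)`, evaluated in two ways.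

In polar coordinates the integrand separates, so for `q = p` the Gaussian integral is the sphere
integral times `Γ((k + s + 2n)/2) / 2` (`gaussianIntegral_eq_mul_knappSteinIntegral`).

On the other hand, integration by parts trades a factor `z_i` or `z̄_i` for the conjugate Wirtinger
derivative of the rest. Applied to Euler's identity `k q = ∑ X_i ∂_i q`, the terms with both
derivatives on `q` add up to twice the Laplacian and vanish for harmonic `q`. What remains is a
recursion to the derivative of `q` along `-iη`, with `s` lowered by one and the parity flipped
(`gaussianIntegral_of_harmonic`). After `k` steps `q` has become a constant proportional to
`q(-iη)`, and a one-dimensional Gamma integral is left. The result holds for `Re s > k` and extends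
to `Re s > -1` by the identity theorem (`gaussianIntegral_eq`).

Since `p(-iη) = (-i)^k (-1)^β p(η)`, the sphere integral is an explicit Gamma quotient times
`p_μ(η)` (`knappSteinIntegral_eq`), which supplies the meromorphic continuation. For non-integral
`μ` the reflection formula turns its quotient by `C_{2n}` into the stated scalar
(`inv_normalization_mul_eigenvalue`). The integers are isolated, so the normal form of the quotient
takes the stated value wherever the scalar is analytic. -/

/-- The function `|t| ^ s (sgn t) ^ δ` of a real variable. -/
def signedPow (s : ℂ) (δ : ZMod 2) (t : ℝ) : ℂ := ((|t| : ℝ) : ℂ) ^ s * sgnPow t δ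

theorem norm_sgnPow_le (t : ℝ) (δ : ZMod 2) : ‖sgnPow t δ‖ ≤ 1 := by
  rw [sgnPow, norm_pow]
  refine pow_le_one₀ (norm_nonneg _) ?_
  rcases lt_trichotomy t 0 with h | h | h <;> simp [h]

theorem norm_ofReal_abs_cpow_le (s : ℂ) (t : ℝ) : ‖((|t| : ℝ) : ℂ) ^ s‖ ≤ |t| ^ s.re := by
  rcases eq_or_ne t 0 with rfl | h
  -- Equality fails only at `t = 0` with `s ≠ 0` and `Re s = 0`: the left side is then `0`, while `0
  -- ^ 0 = 1` for real powers.
  · rcases eq_or_ne s 0 with rfl | hs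
    · simp
    · simpa [hs] using Real.rpow_nonneg le_rfl _
  · rw [Complex.norm_cpow_eq_rpow_re_of_pos (abs_pos.2 h)]

theorem norm_signedPow_le (s : ℂ) (δ : ZMod 2) (t : ℝ) : ‖signedPow s δ t‖ ≤ |t| ^ s.re := by
  rw [signedPow, norm_mul]
  exact (mul_le_of_le_one_right (norm_nonneg _) (norm_sgnPow_le t δ)).trans
    (norm_ofReal_abs_cpow_le s t)

theorem measurable_sign : Measurable (fun t : ℝ => ((SignType.sign t : SignType) : ℝ)) := by
  have h : (fun t : ℝ => ((SignType.sign t : SignType) : ℝ))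
      = fun t => if t < 0 then -1 else if 0 < t then 1 else 0 := by
    funext t
    rcases lt_trichotomy t 0 with h | h | h <;> simp [h, h.not_gt]
  rw [h]
  exact Measurable.ite measurableSet_Iio measurable_const
    (Measurable.ite measurableSet_Ioi measurable_const measurable_const)

theorem measurable_sgnPow (δ : ZMod 2) : Measurable (fun t : ℝ => sgnPow t δ) :=
  (Complex.measurable_ofReal.comp measurable_sign).pow_const _

theorem measurable_signedPow (s : ℂ) (δ : ZMod 2) : Measurable (signedPow s δ) :=
  ((Complex.measurable_ofReal.comp measurable_norm).pow_const s).mul (measurable_sgnPow δ)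

theorem sgnPow_neg (t : ℝ) (δ : ZMod 2) : sgnPow (-t) δ = (-1) ^ δ.val * sgnPow t δ := by
  rw [sgnPow, sgnPow, Left.sign_neg, ← mul_pow]
  congr 1
  rcases lt_trichotomy t 0 with h | h | h <;> simp [h]

theorem sgnPow_pos {t : ℝ} (ht : 0 < t) (δ : ZMod 2) : sgnPow t δ = 1 := by
  simp [sgnPow, ht]

theorem signedPow_mul_of_pos {c : ℝ} (hc : 0 < c) (s : ℂ) (δ : ZMod 2) (t : ℝ) :
    signedPow s δ (c * t) = (c : ℂ) ^ s * signedPow s δ t := by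
  have h : sgnPow (c * t) δ = sgnPow t δ := by
    rw [sgnPow, sgnPow, sign_mul, sign_pos hc, one_mul]
  rw [signedPow, signedPow, h, abs_mul, abs_of_pos hc, Complex.ofReal_mul,
    Complex.mul_cpow_ofReal_nonneg hc.le (abs_nonneg t), mul_assoc]

theorem signedPow_neg (s : ℂ) (δ : ZMod 2) (t : ℝ) :
    signedPow s δ (-t) = (-1) ^ δ.val * signedPow s δ t := by
  rw [signedPow, signedPow, abs_neg, sgnPow_neg]
  ring

theorem neg_one_pow_val_add_one (δ : ZMod 2) : (-1 : ℂ) ^ (δ + 1).val = -(-1) ^ δ.val := by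
  fin_cases δ
  · change (-1 : ℂ) ^ 1 = -(-1) ^ 0
    simp
  · change (-1 : ℂ) ^ 0 = -(-1) ^ 1
    simp

theorem hasDerivAt_signedPow {s : ℂ} (hs : 1 < s.re) (δ : ZMod 2) (t : ℝ) :
    HasDerivAt (signedPow s δ) (s * signedPow (s - 1) (δ + 1) t) t := by
  have hs0 : s ≠ 0 := by rintro rfl; simp at hs; linarith
  have hs1 : s - 1 ≠ 0 := by
    intro h
    have := congrArg Complex.re h
    simp at this; linarith
  have pos : ∀ (δ : ZMod 2) {t : ℝ}, 0 < t →
      HasDerivAt (signedPow s δ) (s * signedPow (s - 1) (δ + 1) t) t := by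
    intro δ t ht
    have h2 : HasDerivAt (fun y : ℝ => (y : ℂ) ^ s) (s * (t : ℂ) ^ (s - 1)) t := by
      simpa using (Complex.hasStrictDerivAt_cpow_const (x := (t : ℂ)) (c := s)
        (Complex.ofReal_mem_slitPlane.2 ht)).hasDerivAt.comp_ofReal
    have e : signedPow s δ =ᶠ[nhds t] fun y : ℝ => (y : ℂ) ^ s := by
      filter_upwards [lt_mem_nhds ht] with y hy
      rw [signedPow, sgnPow_pos hy, abs_of_pos hy, mul_one]
    refine (h2.congr_of_eventuallyEq e).congr_deriv ?_
    rw [signedPow, sgnPow_pos ht, abs_of_pos ht, mul_one]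
  rcases lt_trichotomy t 0 with h | rfl | h
  · have h1 := (pos δ (neg_pos.2 h)).scomp t (hasDerivAt_neg t)
    have e : signedPow s δ = fun y => (-1 : ℂ) ^ δ.val * (signedPow s δ ∘ Neg.neg) y := by
      funext y
      rw [← neg_neg y, signedPow_neg]
      simp
    rw [e]
    refine (h1.const_mul _).congr_deriv ?_
    rw [signedPow_neg, neg_one_pow_val_add_one, neg_one_smul]
    have : ((-1 : ℂ) ^ δ.val) * (-1) ^ δ.val = 1 := by
      rw [← mul_pow]; simp
    linear_combination (s * signedPow (s - 1) (δ + 1) t) * this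
  · have z : ∀ δ, signedPow s δ 0 = 0 := fun δ => by simp [signedPow, hs0]
    have z1 : ∀ δ, signedPow (s - 1) δ 0 = 0 := fun δ => by simp [signedPow, hs1]
    rw [z1, mul_zero, hasDerivAt_iff_isLittleO_nhds_zero]
    simp only [zero_add, z, sub_zero, smul_zero]
    -- At the origin `|h|^(Re s) = |h|^(Re s - 1) |h|` is `o(h)`, because `Re s > 1`.
    refine Asymptotics.IsBigO.trans_isLittleO (g := fun h : ℝ => |h| ^ s.re) ?_ ?_
    · refine Asymptotics.isBigO_of_le _ fun h => ?_
      rw [Real.norm_of_nonneg (Real.rpow_nonneg (abs_nonneg h) _)]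
      exact norm_signedPow_le s δ h
    · have e : (fun h : ℝ => |h| ^ s.re) = fun h => |h| ^ (s.re - 1) * |h| := by
        funext h
        rcases eq_or_ne h 0 with rfl | hh
        · simp; rw [Real.zero_rpow]; linarith
        · rw [← Real.rpow_add_one (abs_pos.2 hh).ne']; simp
      rw [e, ← Asymptotics.isLittleO_norm_right]
      have t0 : Filter.Tendsto (fun h : ℝ => |h| ^ (s.re - 1)) (nhds 0) (nhds 0) := by
        have : Continuous fun h : ℝ => |h| ^ (s.re - 1) :=
          continuous_abs.rpow_const fun _ => Or.inr (by linarith)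
        have := this.tendsto 0
        rwa [abs_zero, Real.zero_rpow (by linarith)] at this
      simpa using ((Asymptotics.isLittleO_one_iff ℝ).2 t0).mul_isBigO
        (Asymptotics.isBigO_refl (fun h : ℝ => |h|) (nhds 0))
  · exact pos δ h

/-! ### Gaussian moments of powers on the real line. -/

theorem integrableOn_Iio_comp_abs {f : ℝ → ℂ} (hf : IntegrableOn f (Ioi 0)) :
    IntegrableOn (fun t => f |t|) (Iio 0) := by
  have h : IntegrableOn (fun t => f (-t)) (Iio 0) :=
    IntegrableOn.comp_neg_Iio (c := 0) (by simpa using hf)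
  exact h.congr_fun (fun t ht => by rw [abs_of_neg ht]) measurableSet_Iio

theorem integrable_comp_abs {f : ℝ → ℂ} (hf : IntegrableOn f (Ioi 0)) :
    Integrable fun t => f |t| := by
  have h1 : IntegrableOn (fun t => f |t|) (Ioi 0) :=
    hf.congr_fun (fun t ht => by rw [abs_of_pos ht]) measurableSet_Ioi
  rw [← integrableOn_univ, ← Iio_union_Ici (a := (0 : ℝ)), integrableOn_union]
  exact ⟨integrableOn_Iio_comp_abs hf, Iff.mpr integrableOn_Ici_iff_integrableOn_Ioi h1⟩

theorem integral_comp_abs_eq_two_mul {f : ℝ → ℂ} (hf : IntegrableOn f (Ioi 0)) :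
    ∫ t, f |t| = 2 * ∫ t in Ioi 0, f t := by
  have h1 : ∫ t in Ioi 0, f |t| = ∫ t in Ioi 0, f t :=
    setIntegral_congr_fun measurableSet_Ioi fun t ht => by simp only [abs_of_pos (mem_Ioi.1 ht)]
  have h2 := integral_comp_neg_Ioi (0 : ℝ) (fun t => f |t|)
  simp only [abs_neg, neg_zero] at h2
  have hi := integrable_comp_abs hf
  rw [← intervalIntegral.integral_Iic_add_Ioi (b := (0 : ℝ)) hi.integrableOn hi.integrableOn,
    ← h2, h1, two_mul]

theorem integrable_abs_rpow_mul_exp {a r : ℝ} (ha : 0 < a) (hr : -1 < r) :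
    Integrable fun t : ℝ => |t| ^ r * Real.exp (-a * t ^ 2) := by
  have := (integrable_comp_abs (f := fun t => ((t ^ r * Real.exp (-a * t ^ 2) : ℝ) : ℂ))
    (integrable_rpow_mul_exp_neg_mul_sq ha hr).ofReal.integrableOn).re
  simpa only [RCLike.re_to_complex, Complex.ofReal_re, sq_abs] using this

/-- The substitution `u = t²` in the Mellin integral of `exp(-u)`. -/
theorem integral_Ioi_cpow_mul_exp_neg_sq {s : ℂ} (hs : -1 < s.re) :
    ∫ t in Ioi (0 : ℝ), (t : ℂ) ^ s * Complex.exp (-(t : ℂ) ^ 2)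
      = 1 / 2 * Complex.Gamma ((s + 1) / 2) := by
  have h := mellin_comp_rpow (fun t => Complex.exp (-(t : ℂ))) (s + 1) 2
  have hre : 0 < ((s + 1) / 2).re := by simp; linarith
  rw [Complex.Gamma_eq_integral hre, Complex.GammaIntegral_eq_mellin]
  simp only [mellin, add_sub_cancel_right, smul_eq_mul] at h ⊢
  norm_num at h
  simpa using h

theorem integral_abs_cpow_mul_exp_neg_sq {s : ℂ} (hs : -1 < s.re) :
    ∫ t : ℝ, ((|t| : ℝ) : ℂ) ^ s * Complex.exp (-(t : ℂ) ^ 2) = Complex.Gamma ((s + 1) / 2) := by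
  have hi : IntegrableOn (fun t : ℝ => (t : ℂ) ^ s * Complex.exp (-(t : ℂ) ^ 2)) (Ioi 0) := by
    refine Integrable.mono' (integrable_abs_rpow_mul_exp one_pos hs).integrableOn ?_ ?_
    · fun_prop
    · refine (ae_restrict_iff' measurableSet_Ioi).2 (Filter.Eventually.of_forall fun t ht => ?_)
      rw [norm_mul, Complex.norm_exp]
      have := norm_ofReal_abs_cpow_le s t
      rw [abs_of_pos ht] at this ⊢
      refine mul_le_mul this (le_of_eq ?_) (Real.exp_pos _).le (Real.rpow_nonneg (le_of_lt ht) _)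
      norm_cast
      simp
  have h := integral_comp_abs_eq_two_mul hi
  rw [integral_Ioi_cpow_mul_exp_neg_sq hs] at h
  simp only [← Complex.ofReal_pow, sq_abs] at h ⊢
  rw [h]
  ring

/-! ### Gaussian integrals of functions of one coordinate -/

section Gaussian

variable {F : Type*} [NormedAddCommGroup F] [InnerProductSpace ℝ F] [FiniteDimensional ℝ F]
  [MeasurableSpace F] [BorelSpace F]

/-- The factors of a Gaussian times a function of the first coordinate. -/
def gaussianFactor {m : ℕ} (a : ℝ) (g : ℝ → ℂ) (i : Fin (m + 1)) (t : ℝ) : ℂ :=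
  (if i = 0 then g t else 1) * (Real.exp (-a * t ^ 2) : ℂ)

/-- Extend `e` to an orthonormal basis. In these coordinates the Gaussian factorizes and `g`
involves the zeroth coordinate only, so Fubini reduces everything to the line. -/
theorem exists_measurableEquiv_gaussian {m : ℕ} (hm : Module.finrank ℝ F = m + 1) {e : F}
    (he : ‖e‖ = 1) :
    ∃ Φ : F ≃ᵐ (Fin (m + 1) → ℝ), MeasurePreserving Φ volume volume ∧
      ∀ (a : ℝ) (g : ℝ → ℂ) (x : F), g (inner ℝ e x) * (Real.exp (-a * ‖x‖ ^ 2) : ℂ) =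
        ∏ i, gaussianFactor a g i (Φ x i) := by
  obtain ⟨b, hb⟩ := Orthonormal.exists_orthonormalBasis_extension_of_card_eq (𝕜 := ℝ)
    (ι := Fin (m + 1)) (by simpa using hm) (v := fun _ => e) (s := {0})
    (by
      rw [orthonormal_iff_ite]
      rintro ⟨i, hi⟩ ⟨j, hj⟩
      obtain rfl : i = 0 := hi
      obtain rfl : j = 0 := hj
      simp [he])
  refine ⟨b.measurableEquiv.trans (MeasurableEquiv.toLp 2 (Fin (m + 1) → ℝ)).symm,
    (PiLp.volume_preserving_ofLp (Fin (m + 1))).comp b.measurePreserving_measurableEquiv, ?_⟩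
  intro a g x
  have h0 : b 0 = e := hb 0 rfl
  have hn : ‖x‖ ^ 2 = ∑ i, (b.repr x i) ^ 2 := by
    rw [← b.repr.norm_map, EuclideanSpace.norm_sq_eq]
    simp
  have hΦ : ∀ i, (b.measurableEquiv.trans (MeasurableEquiv.toLp 2 (Fin (m + 1) → ℝ)).symm) x i
      = b.repr x i := fun i => rfl
  simp only [hΦ, gaussianFactor, Finset.prod_mul_distrib, Finset.prod_ite_eq', Finset.mem_univ,
    if_true]
  rw [b.repr_apply_apply, h0, hn, Finset.mul_sum, Real.exp_sum]
  push_cast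
  rfl

theorem integral_gaussianFactor {m : ℕ} {a : ℝ} (i : Fin m) (g : ℝ → ℂ) :
    ∫ t, gaussianFactor a g i.succ t = (Real.sqrt (Real.pi / a) : ℂ) := by
  simp only [gaussianFactor, Fin.succ_ne_zero, if_false, one_mul]
  rw [integral_complex_ofReal, integral_gaussian]

theorem integral_comp_inner_mul_gaussian {m : ℕ} (hm : Module.finrank ℝ F = m + 1) {e : F}
    (he : ‖e‖ = 1) (a : ℝ) (g : ℝ → ℂ) :
    ∫ x : F, g (inner ℝ e x) * (Real.exp (-a * ‖x‖ ^ 2) : ℂ) =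
      (∫ t, g t * (Real.exp (-a * t ^ 2) : ℂ)) * (Real.sqrt (Real.pi / a) : ℂ) ^ m := by
  obtain ⟨Φ, hΦ, h⟩ := exists_measurableEquiv_gaussian hm he
  simp only [h a g]
  rw [hΦ.integral_comp' (g := fun y => ∏ i, gaussianFactor a g i (y i)),
    integral_fintype_prod_volume_eq_prod, Fin.prod_univ_succ]
  simp only [integral_gaussianFactor, Finset.prod_const, Finset.card_univ, Fintype.card_fin]
  simp [gaussianFactor]

theorem integrable_comp_inner_mul_gaussian {m : ℕ} (hm : Module.finrank ℝ F = m + 1) {e : F}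
    (he : ‖e‖ = 1) {a : ℝ} (ha : 0 < a) {g : ℝ → ℂ}
    (hg : Integrable fun t => g t * (Real.exp (-a * t ^ 2) : ℂ)) :
    Integrable fun x : F => g (inner ℝ e x) * (Real.exp (-a * ‖x‖ ^ 2) : ℂ) := by
  obtain ⟨Φ, hΦ, h⟩ := exists_measurableEquiv_gaussian hm he
  simp only [h a g]
  refine (hΦ.integrable_comp_emb Φ.measurableEmbedding
    (g := fun y => ∏ i, gaussianFactor a g i (y i))).2 ?_
  refine Integrable.fintype_prod fun i => ?_
  by_cases hi : i = 0
  · have e : gaussianFactor a g i = fun t => g t * (Real.exp (-a * t ^ 2) : ℂ) := by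
      funext t
      simp [gaussianFactor, hi]
    rwa [e]
  · have e : gaussianFactor a g i = fun t => (Real.exp (-a * t ^ 2) : ℂ) := by
      funext t
      simp [gaussianFactor, hi]
    rw [e]
    exact (integrable_exp_neg_mul_sq ha).ofReal

end Gaussian

/-! ### Gaussian integrals on `ℂⁿ` -/

theorem finrank_Cn (n : ℕ) : Module.finrank ℝ (Cn n) = 2 * n := by
  rw [← Module.finrank_mul_finrank ℝ ℂ (Cn n)]
  simp [Complex.finrank_real_complex]

theorem symplecticForm_eq_inner {n : ℕ} (x η : Cn n) :
    symplecticForm n x η = inner ℝ (-Complex.I • η) x := by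
  rw [real_inner_comm, symplecticForm]
  have : (inner ℝ x (-Complex.I • η) : ℝ) = (inner ℂ x (-Complex.I • η) : ℂ).re := by
    simp [PiLp.inner_apply, Complex.inner]
  rw [this, inner_smul_right]
  simp

/-- The unit vector `-iη / ‖η‖`. -/
def unitVec {n : ℕ} (η : Cn n) : Cn n := (‖η‖⁻¹ : ℝ) • (-Complex.I • η)

theorem norm_unitVec {n : ℕ} {η : Cn n} (hη : η ≠ 0) : ‖unitVec η‖ = 1 := by
  rw [unitVec, norm_smul, norm_smul]
  simp [hη]

theorem symplecticForm_eq_norm_mul {n : ℕ} {η : Cn n} (hη : η ≠ 0) (x : Cn n) :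
    symplecticForm n x η = ‖η‖ * inner ℝ (unitVec η) x := by
  rw [symplecticForm_eq_inner, unitVec, real_inner_smul_left, mul_inv_cancel_left₀]
  simpa using hη

theorem ae_symplecticForm_ne_zero {n : ℕ} {η : Cn n} (hη : η ≠ 0) :
    ∀ᵐ x : Cn n, symplecticForm n x η ≠ 0 := by
  have h : LinearMap.ker (innerₗ (Cn n) (-Complex.I • η)) ≠ ⊤ := by
    intro h
    have : (-Complex.I • η) ∈ LinearMap.ker (innerₗ (Cn n) (-Complex.I • η)) := by
      rw [h]; trivial
    simp [hη] at this
  have := Measure.addHaar_submodule (volume : Measure (Cn n)) _ h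
  rw [ae_iff]
  convert this using 2
  ext x
  simp only [ne_eq, not_not, symplecticForm_eq_inner]
  rfl

theorem continuous_symplecticForm {n : ℕ} (η : Cn n) :
    Continuous fun x => symplecticForm n x η := by
  simp only [symplecticForm_eq_inner]
  fun_prop

theorem integrable_abs_symplecticForm_rpow {n : ℕ} (hn : 1 ≤ n) {η : Cn n} (hη : η ≠ 0) {a r : ℝ}
    (ha : 0 < a) (hr : -1 < r) :
    Integrable fun x : Cn n => |symplecticForm n x η| ^ r * Real.exp (-a * ‖x‖ ^ 2) := by
  -- One coordinate along `unitVec η` and `2n - 1` orthogonal ones; the truncated subtraction is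
  -- harmless since `n ≥ 1`.
  have hf : Module.finrank ℝ (Cn n) = (2 * n - 1) + 1 := by rw [finrank_Cn]; omega
  have h1 := (integrable_abs_rpow_mul_exp ha hr).ofReal (𝕜 := ℂ)
  have h := (integrable_comp_inner_mul_gaussian hf (norm_unitVec hη) ha
    (g := fun t => ((|t| ^ r : ℝ) : ℂ)) (h1.congr
      (Filter.Eventually.of_forall fun t => Complex.ofReal_mul _ _))).re
  have h2 := h.const_mul (‖η‖ ^ r)
  refine h2.congr (Filter.Eventually.of_forall fun x => ?_)
  simp only [symplecticForm_eq_norm_mul hη, abs_mul, abs_norm]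
  rw [Real.mul_rpow (norm_nonneg _) (abs_nonneg _), mul_assoc, ← Complex.ofReal_mul,
    RCLike.re_to_complex, Complex.ofReal_re]

theorem exists_norm_evalAt_mul_exp_le {n : ℕ} (q : MvPolynomial (Fin n ⊕ Fin n) ℂ) :
    ∀ a : ℝ, 0 < a → ∃ C, ∀ x : Cn n, ‖evalAt q x‖ * Real.exp (-a * ‖x‖ ^ 2) ≤ C := by
  induction q using MvPolynomial.induction_on with
  | C c =>
    intro a ha
    refine ⟨‖c‖, fun x => ?_⟩
    rw [evalAt, MvPolynomial.eval_C]
    refine mul_le_of_le_one_right (norm_nonneg _) (Real.exp_le_one_iff.2 ?_)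
    nlinarith [sq_nonneg ‖x‖]
  | add p q hp hq =>
    intro a ha
    obtain ⟨C, hC⟩ := hp a ha
    obtain ⟨D, hD⟩ := hq a ha
    refine ⟨C + D, fun x => le_trans ?_ (add_le_add (hC x) (hD x))⟩
    rw [← add_mul, evalAt, map_add]
    exact mul_le_mul_of_nonneg_right (norm_add_le _ _) (Real.exp_pos _).le
  | mul_X p i hp =>
    intro a ha
    -- Half of the Gaussian bounds `p`, the other half the new variable; hence the induction runs
    -- over all `a > 0` at once.
    obtain ⟨C, hC⟩ := hp (a / 2) (by positivity)
    have hX : ∀ x : Cn n, ‖evalAt (MvPolynomial.X i) x‖ * Real.exp (-(a / 2) * ‖x‖ ^ 2)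
        ≤ 1 + 2 / a := by
      intro x
      have h1 : ‖evalAt (MvPolynomial.X i) x‖ ≤ ‖x‖ := by
        rw [evalAt, MvPolynomial.eval_X]
        rcases i with i | i <;> simp [PiLp.norm_apply_le]
      have h2 : ‖x‖ ≤ 1 + ‖x‖ ^ 2 := by nlinarith [sq_nonneg (‖x‖ - 1), norm_nonneg x]
      have h3 := Real.add_one_le_exp (a / 2 * ‖x‖ ^ 2)
      have h4 : Real.exp (-(a / 2) * ‖x‖ ^ 2) ≤ 1 :=
        Real.exp_le_one_iff.2 (by nlinarith [sq_nonneg ‖x‖])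
      have h5 : ‖x‖ ^ 2 * Real.exp (-(a / 2) * ‖x‖ ^ 2) ≤ 2 / a := by
        rw [neg_mul, Real.exp_neg, ← div_eq_mul_inv, div_le_div_iff₀ (Real.exp_pos _) ha]
        linarith
      calc _ ≤ (1 + ‖x‖ ^ 2) * Real.exp (-(a / 2) * ‖x‖ ^ 2) :=
            mul_le_mul_of_nonneg_right (h1.trans h2) (Real.exp_pos _).le
        _ ≤ 1 + 2 / a := by rw [add_mul, one_mul]; exact add_le_add h4 h5
    refine ⟨C * (1 + 2 / a), fun x => ?_⟩
    have e : ‖evalAt (p * MvPolynomial.X i) x‖ * Real.exp (-a * ‖x‖ ^ 2)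
        = (‖evalAt p x‖ * Real.exp (-(a / 2) * ‖x‖ ^ 2)) *
          (‖evalAt (MvPolynomial.X i) x‖ * Real.exp (-(a / 2) * ‖x‖ ^ 2)) := by
      have : Real.exp (-a * ‖x‖ ^ 2)
          = Real.exp (-(a / 2) * ‖x‖ ^ 2) * Real.exp (-(a / 2) * ‖x‖ ^ 2) := by
        rw [← Real.exp_add]; congr 1; ring
      rw [evalAt, map_mul, norm_mul, this]
      simp only [evalAt]
      ring
    rw [e]
    refine mul_le_mul (hC x) (hX x) (by positivity) (le_trans (by positivity) (hC x))

/-- The integrand of `gaussianIntegral`. -/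
def gaussianIntegrand {n : ℕ} (η : Cn n) (q : MvPolynomial (Fin n ⊕ Fin n) ℂ) (s : ℂ) (δ : ZMod 2)
    (x : Cn n) : ℂ :=
  evalAt q x * signedPow s δ (symplecticForm n x η) * (Real.exp (-‖x‖ ^ 2) : ℂ)

/-- The integral `∫ q(x) |ω(x, η)| ^ s (sgn ω(x, η)) ^ δ exp (-‖x‖²) dx` over `ℂⁿ`. -/
def gaussianIntegral {n : ℕ} (η : Cn n) (q : MvPolynomial (Fin n ⊕ Fin n) ℂ) (s : ℂ)
    (δ : ZMod 2) : ℂ :=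
  ∫ x : Cn n, gaussianIntegrand η q s δ x

theorem aestronglyMeasurable_gaussianIntegrand {n : ℕ} (η : Cn n)
    (q : MvPolynomial (Fin n ⊕ Fin n) ℂ) (s : ℂ) (δ : ZMod 2) :
    AEStronglyMeasurable (gaussianIntegrand η q s δ) :=
  (((contDiff_evalAt q).continuous.measurable.mul
    ((measurable_signedPow s δ).comp (continuous_symplecticForm η).measurable)).mul
    (by fun_prop)).aestronglyMeasurable

theorem exists_norm_evalAt_mul_exp_neg_le {n : ℕ} (q : MvPolynomial (Fin n ⊕ Fin n) ℂ) :
    ∃ C, 0 ≤ C ∧ ∀ x : Cn n,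
      ‖evalAt q x‖ * Real.exp (-‖x‖ ^ 2) ≤ C * Real.exp (-(1 / 2) * ‖x‖ ^ 2) := by
  obtain ⟨C, hC⟩ := exists_norm_evalAt_mul_exp_le q (1 / 2) (by norm_num)
  refine ⟨C, le_trans (by positivity) (hC 0), fun x => ?_⟩
  have : Real.exp (-‖x‖ ^ 2)
      = Real.exp (-(1 / 2) * ‖x‖ ^ 2) * Real.exp (-(1 / 2) * ‖x‖ ^ 2) := by
    rw [← Real.exp_add]; congr 1; ring
  rw [this, ← mul_assoc]
  exact mul_le_mul_of_nonneg_right (hC x) (Real.exp_pos _).le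

theorem integrable_gaussianIntegrand {n : ℕ} (hn : 1 ≤ n) {η : Cn n} (hη : η ≠ 0)
    (q : MvPolynomial (Fin n ⊕ Fin n) ℂ) {s : ℂ} (hs : -1 < s.re) (δ : ZMod 2) :
    Integrable (gaussianIntegrand η q s δ) := by
  obtain ⟨C, hC0, hC⟩ := exists_norm_evalAt_mul_exp_neg_le q
  refine Integrable.mono' ((integrable_abs_symplecticForm_rpow hn hη (a := 1 / 2) (by norm_num)
    hs).const_mul C) (aestronglyMeasurable_gaussianIntegrand η q s δ)
    (Filter.Eventually.of_forall fun x => ?_)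
  rw [gaussianIntegrand, norm_mul, norm_mul, Complex.norm_real,
    Real.norm_of_nonneg (Real.exp_pos _).le, mul_right_comm]
  calc _ ≤ (C * Real.exp (-(1 / 2) * ‖x‖ ^ 2)) * |symplecticForm n x η| ^ s.re :=
        mul_le_mul (hC x) (norm_signedPow_le _ _ _) (norm_nonneg _) (by positivity)
    _ = _ := by ring

theorem gaussianIntegral_one {n : ℕ} (hn : 1 ≤ n) {η : Cn n} (hη : η ≠ 0) {s : ℂ}
    (hs : -1 < s.re) :
    gaussianIntegral η 1 s 0 = (Real.sqrt Real.pi : ℂ) ^ (2 * n - 1) * (‖η‖ : ℂ) ^ s *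
      Complex.Gamma ((s + 1) / 2) := by
  have hf : Module.finrank ℝ (Cn n) = (2 * n - 1) + 1 := by rw [finrank_Cn]; omega
  have h := integral_comp_inner_mul_gaussian hf (norm_unitVec hη) 1
    (fun t => ((|t| : ℝ) : ℂ) ^ s)
  have h1 : ∫ t : ℝ, ((|t| : ℝ) : ℂ) ^ s * (Real.exp (-1 * t ^ 2) : ℂ)
      = Complex.Gamma ((s + 1) / 2) := by
    rw [← integral_abs_cpow_mul_exp_neg_sq hs]
    simp
  rw [h1, div_one] at h
  rw [gaussianIntegral, mul_comm (_ ^ _) ((‖η‖ : ℂ) ^ s), mul_assoc,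
    mul_comm (_ ^ _) (Complex.Gamma _), ← h, ← integral_const_mul]
  congr 1 with x
  rw [gaussianIntegrand, symplecticForm_eq_norm_mul hη, signedPow_mul_of_pos (norm_pos_iff.2 hη)]
  simp [evalAt, signedPow, sgnPow, mul_assoc]

/-! ### Directional derivatives of polynomials in `z` and `z̄` -/

/-- The values of the variables `z` and `z̄` at a point. -/
def coords {n : ℕ} (z : Cn n) : Fin n ⊕ Fin n → ℂ :=
  Sum.elim (fun i => z i) (fun i => starRingEnd ℂ (z i))

/-- The derivative in the direction `v`, on polynomials in `z` and `z̄`. -/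
def dirDeriv {n : ℕ} (v : Cn n) :
    Derivation ℂ (MvPolynomial (Fin n ⊕ Fin n) ℂ) (MvPolynomial (Fin n ⊕ Fin n) ℂ) :=
  ∑ i, coords v i • MvPolynomial.pderiv i

theorem dirDeriv_apply {n : ℕ} (v : Cn n) (q : MvPolynomial (Fin n ⊕ Fin n) ℂ) :
    dirDeriv v q = ∑ i, coords v i • MvPolynomial.pderiv i q := by
  have h := congrFun (map_sum (Derivation.coeFnAddMonoidHom (R := ℂ)
    (A := MvPolynomial (Fin n ⊕ Fin n) ℂ) (M := MvPolynomial (Fin n ⊕ Fin n) ℂ))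
    (fun i => coords v i • MvPolynomial.pderiv i) Finset.univ) q
  rw [Finset.sum_apply] at h
  exact h

theorem dirDeriv_X {n : ℕ} (v : Cn n) (i : Fin n ⊕ Fin n) :
    dirDeriv v (MvPolynomial.X i) = MvPolynomial.C (coords v i) := by
  rw [dirDeriv_apply, Finset.sum_eq_single i]
  · simp [MvPolynomial.smul_eq_C_mul]
  · intro j _ hj
    rw [MvPolynomial.pderiv_X_of_ne hj.symm, smul_zero]
  · simp

theorem hasLineDerivAt_evalAt {n : ℕ} (q : MvPolynomial (Fin n ⊕ Fin n) ℂ) (x v : Cn n) :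
    HasLineDerivAt ℝ (evalAt q) (evalAt (dirDeriv v q) x) x v := by
  induction q using MvPolynomial.induction_on with
  | C c =>
    have h1 : evalAt (MvPolynomial.C c) = fun _ : Cn n => c := by
      funext y
      rw [evalAt, MvPolynomial.eval_C]
    have h2 : dirDeriv v (MvPolynomial.C c) = 0 := (dirDeriv v).map_algebraMap c
    rw [h1, h2, evalAt, map_zero]
    exact hasDerivAt_const _ _
  | add p q hp hq =>
    have h1 : (evalAt (p + q) : Cn n → ℂ) = fun y => evalAt p y + evalAt q y := by
      funext y
      simp [evalAt]
    have h2 : evalAt (dirDeriv v (p + q)) x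
        = evalAt (dirDeriv v p) x + evalAt (dirDeriv v q) x := by simp [evalAt]
    rw [h1, h2]
    exact HasDerivAt.add hp hq
  | mul_X p i hp =>
    have hX : HasLineDerivAt ℝ (evalAt (MvPolynomial.X i)) (coords v i) x v := by
      have h : HasDerivAt (fun t : ℝ => coords x i + (t : ℂ) * coords v i) (coords v i) 0 := by
        simpa using ((Complex.ofRealCLM.hasDerivAt (x := 0)).mul_const (coords v i)).const_add
          (coords x i)
      refine h.congr_of_eventuallyEq (Filter.Eventually.of_forall fun t => ?_)
      rcases i with i | i <;> simp [evalAt, coords]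
    have h1 : (evalAt (p * MvPolynomial.X i) : Cn n → ℂ)
        = fun y => evalAt p y * evalAt (MvPolynomial.X i) y := by
      funext y
      simp [evalAt]
    have h2 : evalAt (dirDeriv v (p * MvPolynomial.X i)) x
        = evalAt (dirDeriv v p) x * evalAt (MvPolynomial.X i) x + evalAt p x * coords v i := by
      rw [Derivation.leibniz, dirDeriv_X]
      simp [evalAt]
      ring
    rw [h1, h2]
    have := HasDerivAt.mul hp hX
    simp only [zero_smul, add_zero] at this
    exact this

/-- The linear polynomial representing `2 Re ⟨v, ·⟩`. -/
def innerPoly {n : ℕ} (v : Cn n) : MvPolynomial (Fin n ⊕ Fin n) ℂ :=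
  ∑ i, coords v i.swap • MvPolynomial.X i

theorem evalAt_innerPoly {n : ℕ} (v x : Cn n) :
    evalAt (innerPoly v) x = ((2 * inner ℝ x v : ℝ) : ℂ) := by
  simp only [innerPoly, evalAt, map_sum,
    Fintype.sum_sum_type, coords, Sum.swap_inl, Sum.swap_inr, Sum.elim_inl, Sum.elim_inr,
    PiLp.inner_apply, ← Finset.sum_add_distrib, Finset.mul_sum, Complex.ofReal_sum]
  refine Finset.sum_congr rfl fun i _ => ?_
  rw [Complex.inner]
  apply Complex.ext <;> simp <;> ring

theorem hasLineDerivAt_exp_neg_norm_sq {n : ℕ} (x v : Cn n) :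
    HasLineDerivAt ℝ (fun y : Cn n => (Real.exp (-‖y‖ ^ 2) : ℂ))
      (-evalAt (innerPoly v) x * (Real.exp (-‖x‖ ^ 2) : ℂ)) x v := by
  have h1 : HasDerivAt (fun t : ℝ => x + t • v) v 0 := by
    simpa using ((hasDerivAt_id (0 : ℝ)).smul_const v).const_add x
  have h2 := (h1.norm_sq.neg.exp).ofReal_comp
  simp only [zero_smul, add_zero] at h2
  refine h2.congr_deriv ?_
  simp only [Pi.neg_apply, zero_smul, add_zero]
  rw [evalAt_innerPoly]
  push_cast
  ring

theorem hasLineDerivAt_signedPow {n : ℕ} {s : ℂ} (hs : 1 < s.re) (δ : ZMod 2) (x v η : Cn n) :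
    HasLineDerivAt ℝ (fun y : Cn n => signedPow s δ (symplecticForm n y η))
      ((symplecticForm n v η : ℂ) * (s * signedPow (s - 1) (δ + 1) (symplecticForm n x η))) x v := by
  have h1 : HasDerivAt (fun t : ℝ => symplecticForm n (x + t • v) η) (symplecticForm n v η) 0 := by
    have e : (fun t : ℝ => symplecticForm n (x + t • v) η)
        = fun t => symplecticForm n x η + t * symplecticForm n v η := by
      funext t
      simp only [symplecticForm_eq_inner, inner_add_right, real_inner_smul_right]
    rw [e]
    simpa using ((hasDerivAt_id (0 : ℝ)).mul_const (symplecticForm n v η)).const_add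
      (symplecticForm n x η)
  have h2 := HasDerivAt.scomp_of_eq (0 : ℝ) (hasDerivAt_signedPow hs δ (symplecticForm n x η)) h1
    (by simp)
  simpa [HasLineDerivAt, Function.comp_def] using h2

/-! ### Integration by parts -/

section IntegrationByParts

variable {n : ℕ} {η : Cn n}

theorem gaussianIntegral_add (hn : 1 ≤ n) (hη : η ≠ 0) (p q : MvPolynomial (Fin n ⊕ Fin n) ℂ)
    {s : ℂ} (hs : -1 < s.re) (δ : ZMod 2) :
    gaussianIntegral η (p + q) s δ = gaussianIntegral η p s δ + gaussianIntegral η q s δ := by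
  simp only [gaussianIntegral]
  rw [← integral_add (integrable_gaussianIntegrand hn hη p hs δ)
    (integrable_gaussianIntegrand hn hη q hs δ)]
  congr 1 with x
  simp only [gaussianIntegrand, evalAt, map_add]
  ring

theorem gaussianIntegral_smul (c : ℂ) (q : MvPolynomial (Fin n ⊕ Fin n) ℂ) (s : ℂ) (δ : ZMod 2) :
    gaussianIntegral η (c • q) s δ = c * gaussianIntegral η q s δ := by
  simp only [gaussianIntegral]
  rw [← integral_const_mul]
  congr 1 with x
  simp only [gaussianIntegrand, evalAt, MvPolynomial.smul_eval]
  ring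

/-- The Gaussian integral as a linear form in the polynomial. -/
def gaussianForm (hn : 1 ≤ n) (hη : η ≠ 0) {s : ℂ} (hs : -1 < s.re) (δ : ZMod 2) :
    MvPolynomial (Fin n ⊕ Fin n) ℂ →ₗ[ℂ] ℂ where
  toFun q := gaussianIntegral η q s δ
  map_add' p q := gaussianIntegral_add hn hη p q hs δ
  map_smul' c q := gaussianIntegral_smul c q s δ

/-- The derivative of `exp(-‖x‖²)` along `v` is `-innerPoly v` times itself, so this is integration
by parts along `v`. The condition `Re s > 1` makes the signed power differentiable also on the
hyperplane `ω(x, η) = 0`. -/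
theorem gaussianIntegral_innerPoly_mul (hn : 1 ≤ n) (hη : η ≠ 0) {s : ℂ} (hs : 1 < s.re)
    (δ : ZMod 2) (v : Cn n) (q : MvPolynomial (Fin n ⊕ Fin n) ℂ) :
    gaussianIntegral η (innerPoly v * q) s δ = gaussianIntegral η (dirDeriv v q) s δ +
      symplecticForm n v η * s * gaussianIntegral η q (s - 1) (δ + 1) := by
  have hs1 : -1 < s.re := by linarith
  have hs2 : -1 < (s - 1).re := by simp; linarith
  set f : Cn n → ℂ := fun x => evalAt q x * signedPow s δ (symplecticForm n x η) with hf
  set f' : Cn n → ℂ := fun x => evalAt (dirDeriv v q) x * signedPow s δ (symplecticForm n x η) +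
    evalAt q x * ((symplecticForm n v η : ℂ) *
      (s * signedPow (s - 1) (δ + 1) (symplecticForm n x η))) with hf'
  set g : Cn n → ℂ := fun x => (Real.exp (-‖x‖ ^ 2) : ℂ) with hg
  set g' : Cn n → ℂ := fun x => -evalAt (innerPoly v) x * (Real.exp (-‖x‖ ^ 2) : ℂ) with hg'
  have e1 : (fun x => f' x * g x) = fun x => gaussianIntegrand η (dirDeriv v q) s δ x +
      symplecticForm n v η * s * gaussianIntegrand η q (s - 1) (δ + 1) x := by
    funext x
    simp only [hf', hg, gaussianIntegrand]
    ring
  have e2 : (fun x => f x * g' x) = fun x => -gaussianIntegrand η (innerPoly v * q) s δ x := by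
    funext x
    simp only [hf, hg', gaussianIntegrand, evalAt, map_mul]
    ring
  have i1 := integrable_gaussianIntegrand hn hη (dirDeriv v q) hs1 δ
  have i2 := (integrable_gaussianIntegrand hn hη q hs2 (δ + 1)).const_mul
    (symplecticForm n v η * s)
  have h := integral_bilinear_hasLineDerivAt_right_eq_neg_left_of_integrable
    (μ := (volume : Measure (Cn n))) (f := f) (f' := f') (g := g) (g' := g') (v := v)
    (B := ContinuousLinearMap.mul ℝ ℂ)
    (by simp only [ContinuousLinearMap.mul_apply', e1]; exact i1.add i2)
    (by simp only [ContinuousLinearMap.mul_apply', e2]; exact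
      (integrable_gaussianIntegrand hn hη (innerPoly v * q) hs1 δ).neg)
    (by simp only [ContinuousLinearMap.mul_apply']; exact
      integrable_gaussianIntegrand hn hη q hs1 δ)
    (fun x _ => by
      have := HasDerivAt.mul (hasLineDerivAt_evalAt q x v) (hasLineDerivAt_signedPow hs δ x v η)
      simp only [zero_smul, add_zero] at this
      exact this)
    (fun x _ => hasLineDerivAt_exp_neg_norm_sq x v)
  simp only [ContinuousLinearMap.mul_apply', e1, e2] at h
  rw [integral_neg, neg_inj, integral_add i1 i2, integral_const_mul] at h
  exact h

theorem coords_single (j : Fin n) (c : ℂ) (i : Fin n ⊕ Fin n) :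
    coords (EuclideanSpace.single j c) i =
      (Pi.single (Sum.inl j) c + Pi.single (Sum.inr j) (starRingEnd ℂ c) : Fin n ⊕ Fin n → ℂ) i := by
  rcases i with i | i
  · simp [coords, Pi.single_apply]
  · rcases eq_or_ne i j with rfl | h <;> simp [coords, *]

theorem dirDeriv_single (j : Fin n) (c : ℂ) (q : MvPolynomial (Fin n ⊕ Fin n) ℂ) :
    dirDeriv (EuclideanSpace.single j c) q = c • MvPolynomial.pderiv (Sum.inl j) q +
      starRingEnd ℂ c • MvPolynomial.pderiv (Sum.inr j) q := by
  simp only [dirDeriv_apply, coords_single, Pi.add_apply, add_smul, Finset.sum_add_distrib,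
    Pi.single_apply, ite_smul, zero_smul, Finset.sum_ite_eq', Finset.mem_univ, if_true]

theorem innerPoly_single (j : Fin n) (c : ℂ) :
    innerPoly (EuclideanSpace.single j c) = starRingEnd ℂ c • MvPolynomial.X (Sum.inl j) +
      c • MvPolynomial.X (Sum.inr j) := by
  simp only [innerPoly, Fintype.sum_sum_type, Sum.swap_inl, Sum.swap_inr, coords_single,
    Pi.add_apply, Pi.single_apply, reduceCtorEq, if_false, zero_add, add_zero, Sum.inl.injEq,
    Sum.inr.injEq, ite_smul, zero_smul, Finset.sum_ite_eq', Finset.mem_univ, if_true]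

theorem symplecticForm_single (j : Fin n) (c : ℂ) :
    symplecticForm n (EuclideanSpace.single j c) η = (starRingEnd ℂ c * η j).im := by
  rw [symplecticForm, EuclideanSpace.inner_single_left]

/-- The Wirtinger form of the integration by parts: `∂/∂z̄_j` of the Gaussian is `-z_j` times it,
which explains the `swap`. As `ω(x, η) = Re ⟨-iη, x⟩`, its derivative in `z̄_j` is half the `j`-th
coordinate of `-iη`. -/
theorem gaussianIntegral_X_mul (hn : 1 ≤ n) (hη : η ≠ 0) {s : ℂ} (hs : 1 < s.re)
    (δ : ZMod 2) (i : Fin n ⊕ Fin n) (q : MvPolynomial (Fin n ⊕ Fin n) ℂ) :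
    gaussianIntegral η (MvPolynomial.X i * q) s δ =
      gaussianIntegral η (MvPolynomial.pderiv i.swap q) s δ +
        s / 2 * coords (-Complex.I • η) i * gaussianIntegral η q (s - 1) (δ + 1) := by
  have hs1 : -1 < s.re := by linarith
  have key : ∀ (j : Fin n) (c : ℂ),
      starRingEnd ℂ c * gaussianIntegral η (MvPolynomial.X (Sum.inl j) * q) s δ +
        c * gaussianIntegral η (MvPolynomial.X (Sum.inr j) * q) s δ =
      c * gaussianIntegral η (MvPolynomial.pderiv (Sum.inl j) q) s δ +
        starRingEnd ℂ c * gaussianIntegral η (MvPolynomial.pderiv (Sum.inr j) q) s δ +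
        (starRingEnd ℂ c * η j).im * s * gaussianIntegral η q (s - 1) (δ + 1) := by
    intro j c
    have h := gaussianIntegral_innerPoly_mul hn hη hs δ (EuclideanSpace.single j c) q
    rw [dirDeriv_single, innerPoly_single, symplecticForm_single, add_mul, smul_mul_assoc,
      smul_mul_assoc, gaussianIntegral_add hn hη _ _ hs1, gaussianIntegral_add hn hη _ _ hs1] at h
    simpa only [gaussianIntegral_smul] using h
  rcases i with j | j
  · have h1 := key j 1
    have hI := key j Complex.I
    have e : ((η j).im : ℂ) - Complex.I * ((η j).re : ℂ) = -Complex.I * η j := by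
      apply Complex.ext <;> simp
    simp at h1 hI
    simp only [coords, Sum.elim_inl, Sum.swap_inl, PiLp.smul_apply, smul_eq_mul, ← e]
    -- The real directions `e_j` and `i e_j` are combined as in `∂/∂z̄_j = (∂_x + i ∂_y)/2`; the
    -- multiple of `I_sq` accounts for `i² = -1`.
    linear_combination (1 / 2 : ℂ) * h1 + (Complex.I / 2) * hI + (1 / 2) *
      (gaussianIntegral η (MvPolynomial.X (Sum.inl j) * q) s δ
       - gaussianIntegral η (MvPolynomial.X (Sum.inr j) * q) s δ
       + gaussianIntegral η (MvPolynomial.pderiv (Sum.inl j) q) s δ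
       - gaussianIntegral η (MvPolynomial.pderiv (Sum.inr j) q) s δ) * Complex.I_sq
  · have h1 := key j 1
    have hI := key j Complex.I
    have e : ((η j).im : ℂ) + Complex.I * ((η j).re : ℂ)
        = starRingEnd ℂ (-Complex.I * η j) := by
      apply Complex.ext <;> simp
    simp at h1 hI
    simp only [coords, Sum.elim_inr, Sum.swap_inr, PiLp.smul_apply, smul_eq_mul, ← e]
    linear_combination (1 / 2 : ℂ) * h1 - (Complex.I / 2) * hI - (1 / 2) *
      (gaussianIntegral η (MvPolynomial.X (Sum.inl j) * q) s δ
       - gaussianIntegral η (MvPolynomial.X (Sum.inr j) * q) s δ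
       + gaussianIntegral η (MvPolynomial.pderiv (Sum.inl j) q) s δ
       - gaussianIntegral η (MvPolynomial.pderiv (Sum.inr j) q) s δ) * Complex.I_sq

theorem complexLaplacian_apply (q : MvPolynomial (Fin n ⊕ Fin n) ℂ) :
    complexLaplacian n q = ∑ j : Fin n, MvPolynomial.pderiv (R := ℂ) (Sum.inl j)
      (MvPolynomial.pderiv (R := ℂ) (Sum.inr j : Fin n ⊕ Fin n) q) := by
  simp [complexLaplacian]

/-- The commutator of two derivations is a derivation, and this one kills every variable. -/
theorem pderiv_comm (i j : Fin n ⊕ Fin n) (q : MvPolynomial (Fin n ⊕ Fin n) ℂ) :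
    MvPolynomial.pderiv i (MvPolynomial.pderiv j q)
      = MvPolynomial.pderiv j (MvPolynomial.pderiv i q) := by
  have h : ⁅MvPolynomial.pderiv (R := ℂ) i, MvPolynomial.pderiv (R := ℂ) j⁆ = (0 : Derivation ℂ (MvPolynomial (Fin n ⊕ Fin n) ℂ) _) := by
    refine MvPolynomial.derivation_ext fun k => ?_
    rw [Derivation.commutator_apply]
    simp [MvPolynomial.pderiv_X, Pi.single_apply, apply_ite]
  have := DFunLike.congr_fun h q
  rwa [Derivation.commutator_apply, Derivation.zero_apply, sub_eq_zero] at this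

theorem complexLaplacian_dirDeriv (v : Cn n) {q : MvPolynomial (Fin n ⊕ Fin n) ℂ}
    (hq : complexLaplacian n q = 0) : complexLaplacian n (dirDeriv v q) = 0 := by
  have h : ∀ i, complexLaplacian n (MvPolynomial.pderiv i q)
      = MvPolynomial.pderiv i (complexLaplacian n q) := by
    intro i
    rw [complexLaplacian_apply, complexLaplacian_apply, map_sum]
    refine Finset.sum_congr rfl fun j _ => ?_
    rw [pderiv_comm _ i q, pderiv_comm _ i]
  rw [dirDeriv_apply, map_sum]
  refine Finset.sum_eq_zero fun i _ => ?_
  rw [map_smul, h, hq, map_zero, smul_zero]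

theorem isHomogeneous_dirDeriv (v : Cn n) {q : MvPolynomial (Fin n ⊕ Fin n) ℂ} {k : ℕ}
    (hq : q.IsHomogeneous (k + 1)) : (dirDeriv v q).IsHomogeneous k := by
  rw [dirDeriv_apply]
  refine MvPolynomial.IsHomogeneous.sum _ _ _ fun i _ => ?_
  rw [MvPolynomial.smul_eq_C_mul]
  have := (MvPolynomial.isHomogeneous_C (Fin n ⊕ Fin n) (coords v i)).mul (hq.pderiv (i := i))
  simpa using this

/-- Euler's identity, the direction and the point of evaluation being the same. -/
theorem evalAt_dirDeriv_self (v : Cn n) {q : MvPolynomial (Fin n ⊕ Fin n) ℂ} {k : ℕ}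
    (hq : q.IsHomogeneous k) : evalAt (dirDeriv v q) v = k * evalAt q v := by
  have h := congrArg (MvPolynomial.eval (coords v)) hq.sum_X_mul_pderiv
  simp only [map_sum, map_mul, MvPolynomial.eval_X, nsmul_eq_mul, map_natCast] at h
  change MvPolynomial.eval (coords v) _ = k * MvPolynomial.eval (coords v) q
  rw [← h, dirDeriv_apply, map_sum]
  simp only [MvPolynomial.smul_eval]

/-- Integrate Euler's identity and apply `gaussianIntegral_X_mul` to each `X_i * ∂_i q`. The second
derivatives sum to twice the Laplacian of `q`, which is zero; the remaining terms reassemble into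
the derivative along `-iη`. -/
theorem gaussianIntegral_of_harmonic (hn : 1 ≤ n) (hη : η ≠ 0) {s : ℂ} (hs : 1 < s.re)
    (δ : ZMod 2) {q : MvPolynomial (Fin n ⊕ Fin n) ℂ} {k : ℕ} (hk : q.IsHomogeneous k)
    (hq : complexLaplacian n q = 0) :
    k * gaussianIntegral η q s δ =
      s / 2 * gaussianIntegral η (dirDeriv (-Complex.I • η) q) (s - 1) (δ + 1) := by
  have hs1 : -1 < s.re := by linarith
  have hs2 : -1 < (s - 1).re := by simp; linarith
  have h := congrArg (gaussianForm hn hη hs1 δ) hk.sum_X_mul_pderiv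
  rw [map_sum, map_nsmul, nsmul_eq_mul] at h
  have h0 : ∑ i : Fin n ⊕ Fin n,
      gaussianForm hn hη hs1 δ (MvPolynomial.pderiv i.swap (MvPolynomial.pderiv i q)) = 0 := by
    rw [← map_sum, Fintype.sum_sum_type]
    have e : ∑ j : Fin n, MvPolynomial.pderiv (Sum.swap (Sum.inl j : Fin n ⊕ Fin n))
        (MvPolynomial.pderiv (Sum.inl j) q) = complexLaplacian n q := by
      rw [complexLaplacian_apply]
      exact Finset.sum_congr rfl fun j _ => pderiv_comm _ _ _
    have e' : ∑ j : Fin n, MvPolynomial.pderiv (Sum.swap (Sum.inr j : Fin n ⊕ Fin n))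
        (MvPolynomial.pderiv (Sum.inr j) q) = complexLaplacian n q := by
      rw [complexLaplacian_apply]
      rfl
    rw [e, e', hq, add_zero, map_zero]
  have h1 : gaussianIntegral η (dirDeriv (-Complex.I • η) q) (s - 1) (δ + 1)
      = ∑ i, coords (-Complex.I • η) i *
        gaussianIntegral η (MvPolynomial.pderiv i q) (s - 1) (δ + 1) := by
    change gaussianForm hn hη hs2 (δ + 1) _ = _
    rw [dirDeriv_apply, map_sum]
    exact Finset.sum_congr rfl fun i _ => map_smul _ _ _
  change _ = (k : ℂ) * gaussianIntegral η q s δ at h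
  rw [← h, h1, Finset.mul_sum, ← zero_add (∑ i, _ * _), ← h0, ← Finset.sum_add_distrib]
  refine Finset.sum_congr rfl fun i _ => ?_
  change gaussianIntegral _ _ _ _ = _
  rw [gaussianIntegral_X_mul hn hη hs, mul_assoc]
  rfl

/-- Under `s ↦ s - 1` the two Gamma factors in the numerator exchange roles, and `Γ(s/2 + 1) = (s/2)
Γ(s/2)` absorbs the factor of the recursion. The bound `k < Re s` keeps `Re s > 1` at every step
that uses the recursion. -/
theorem gaussianIntegral_eq_of_lt_re (hn : 1 ≤ n) (hη : η ≠ 0) (k : ℕ) :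
    ∀ {s : ℂ}, (k : ℝ) < s.re → ∀ {q : MvPolynomial (Fin n ⊕ Fin n) ℂ}, q.IsHomogeneous k →
      complexLaplacian n q = 0 →
      gaussianIntegral η q s (k : ZMod 2) = evalAt q (-Complex.I • η) *
        ((Real.sqrt Real.pi : ℂ) ^ (2 * n - 1) * (‖η‖ : ℂ) ^ (s - k) *
          (Complex.Gamma ((s + 1) / 2) * Complex.Gamma (s / 2 + 1) /
            Complex.Gamma ((s - k) / 2 + 1))) := by
  induction k with
  | zero =>
    intro s hs q hq _
    have hs0 : 0 < s.re := by simpa using hs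
    obtain ⟨c, rfl⟩ : ∃ c, q = MvPolynomial.C c :=
      ⟨_, MvPolynomial.totalDegree_eq_zero_iff_eq_C.1 (Nat.le_zero.1 hq.totalDegree_le)⟩
    have hG : Complex.Gamma (s / 2 + 1) ≠ 0 :=
      Complex.Gamma_ne_zero_of_re_pos (by simp; linarith)
    have e : (MvPolynomial.C c : MvPolynomial (Fin n ⊕ Fin n) ℂ) = c • 1 := by
      rw [MvPolynomial.smul_eq_C_mul, mul_one]
    rw [e, gaussianIntegral_smul, Nat.cast_zero, gaussianIntegral_one hn hη (by linarith)]
    simp [evalAt, hG]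
  | succ k ih =>
    intro s hs q hk hq
    have hs' : (k : ℝ) + 1 < s.re := by exact_mod_cast hs
    have hk0 : (0 : ℝ) ≤ k := k.cast_nonneg
    have h := gaussianIntegral_of_harmonic hn hη (s := s) (by linarith) ((k + 1 : ℕ) : ZMod 2) hk hq
    -- The parity flip of the recursion matches the drop in degree.
    have hδ : ((k + 1 : ℕ) : ZMod 2) + 1 = k := by
      push_cast
      rw [add_assoc, CharTwo.add_self_eq_zero, add_zero]
    rw [hδ, ih (s := s - 1) (by simp; linarith) (isHomogeneous_dirDeriv _ hk)
      (complexLaplacian_dirDeriv _ hq), evalAt_dirDeriv_self _ hk] at h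
    have hk1 : ((k + 1 : ℕ) : ℂ) ≠ 0 := Nat.cast_ne_zero.2 k.succ_ne_zero
    have hG : Complex.Gamma (s / 2 + 1) = s / 2 * Complex.Gamma (s / 2) :=
      Complex.Gamma_add_one _ (by
        intro h0
        have := congrArg Complex.re h0
        simp at this
        linarith)
    apply mul_left_cancel₀ hk1
    rw [h, hG, show s - 1 + 1 = s by ring, show (s - 1) / 2 + 1 = (s + 1) / 2 by ring,
      show s - ((k + 1 : ℕ) : ℂ) = s - 1 - k by push_cast; ring]
    ring

end IntegrationByParts

/-! ### Analytic dependence on the exponent -/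

theorem rpow_le_rpow_add_rpow {x a b c : ℝ} (hx : 0 < x) (hac : a ≤ c) (hcb : c ≤ b) :
    x ^ c ≤ x ^ a + x ^ b := by
  rcases le_total 1 x with h | h
  · exact (Real.rpow_le_rpow_of_exponent_le h hcb).trans
      (le_add_of_nonneg_left (Real.rpow_nonneg hx.le _))
  · exact (Real.rpow_le_rpow_of_exponent_ge hx h hac).trans
      (le_add_of_nonneg_right (Real.rpow_nonneg hx.le _))

/-- A logarithm costs only an arbitrarily small power. The right side does not depend on `r`, so it
can dominate the derivative in the exponent uniformly near `r₀`. -/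
theorem abs_log_mul_rpow_le {x ε r r₀ : ℝ} (hx : 0 < x) (hε : 0 < ε) (hr : |r - r₀| ≤ ε) :
    |Real.log x| * x ^ r ≤ 2 / ε * (x ^ (r₀ - 2 * ε) + x ^ (r₀ + 2 * ε)) := by
  have h1 : |Real.log x| ≤ (x ^ ε + x ^ (-ε)) / ε := by
    have h2 := Real.log_le_rpow_div hx.le hε
    have h3 := Real.log_le_rpow_div (inv_pos.2 hx).le hε
    rw [Real.log_inv, Real.inv_rpow hx.le, ← Real.rpow_neg hx.le] at h3
    have h4 : 0 ≤ x ^ ε / ε := by positivity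
    have h5 : 0 ≤ x ^ (-ε) / ε := by positivity
    rw [add_div]
    exact abs_le.2 ⟨by linarith, by linarith⟩
  obtain ⟨hr1, hr2⟩ := abs_le.1 hr
  calc |Real.log x| * x ^ r ≤ (x ^ ε + x ^ (-ε)) / ε * x ^ r :=
        mul_le_mul_of_nonneg_right h1 (Real.rpow_nonneg hx.le _)
    _ = (x ^ (ε + r) + x ^ (-ε + r)) / ε := by
        rw [Real.rpow_add hx, Real.rpow_add hx]; ring
    _ ≤ ((x ^ (r₀ - 2 * ε) + x ^ (r₀ + 2 * ε)) + (x ^ (r₀ - 2 * ε) + x ^ (r₀ + 2 * ε))) / ε := by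
        gcongr
        · exact rpow_le_rpow_add_rpow hx (by linarith) (by linarith)
        · exact rpow_le_rpow_add_rpow hx (by linarith) (by linarith)
    _ = _ := by ring

theorem hasDerivAt_signedPow_exponent {t : ℝ} (ht : t ≠ 0) (δ : ZMod 2) (s : ℂ) :
    HasDerivAt (fun s => signedPow s δ t) ((Real.log |t| : ℂ) * signedPow s δ t) s := by
  have h0 : ((|t| : ℝ) : ℂ) ≠ 0 := by simpa using ht
  have := ((hasDerivAt_id s).const_cpow (c := ((|t| : ℝ) : ℂ)) (Or.inl h0)).mul_const (sgnPow t δ)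
  refine this.congr_deriv ?_
  rw [signedPow, Complex.ofReal_log (abs_nonneg t)]
  simp only [id, mul_one]
  ring

theorem differentiableAt_Gamma_of_re_pos {z : ℂ} (hz : 0 < z.re) :
    DifferentiableAt ℂ Complex.Gamma z :=
  Complex.differentiableAt_Gamma z fun m h => by
    rw [h] at hz
    simp at hz
    linarith [(m.cast_nonneg : (0 : ℝ) ≤ m)]

section Exponent

variable {n : ℕ} {η : Cn n}

theorem differentiableAt_gaussianIntegral (hn : 1 ≤ n) (hη : η ≠ 0)
    (q : MvPolynomial (Fin n ⊕ Fin n) ℂ) (δ : ZMod 2) {s₀ : ℂ} (hs : -1 < s₀.re) :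
    DifferentiableAt ℂ (fun s : ℂ => gaussianIntegral η q s δ) s₀ := by
  obtain ⟨C, hC0, hC⟩ := exists_norm_evalAt_mul_exp_neg_le q
  -- Chosen so that the lowest exponent in the dominating function, `Re s₀ - 2ε`, still exceeds
  -- `-1`.
  set ε : ℝ := (s₀.re + 1) / 3 with hε
  have hε0 : 0 < ε := by rw [hε]; linarith
  have hmem : ∀ s ∈ ball s₀ ε, |s.re - s₀.re| ≤ ε := by
    intro s h
    rw [← Complex.sub_re]
    exact (Complex.abs_re_le_norm _).trans (by rw [← dist_eq_norm]; exact (mem_ball.1 h).le)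
  have hi := (integrable_abs_symplecticForm_rpow hn hη (a := 1 / 2) (r := s₀.re - 2 * ε)
    (by norm_num) (by rw [hε]; linarith)).add
    (integrable_abs_symplecticForm_rpow hn hη (a := 1 / 2) (r := s₀.re + 2 * ε)
    (by norm_num) (by linarith))
  refine (hasDerivAt_integral_of_dominated_loc_of_deriv_le (ball_mem_nhds s₀ hε0)
    (F' := fun s x => (Real.log |symplecticForm n x η| : ℂ) * gaussianIntegrand η q s δ x)
    (Filter.Eventually.of_forall fun s => aestronglyMeasurable_gaussianIntegrand η q s δ)
    (integrable_gaussianIntegrand hn hη q hs δ) ?_ ?_ (hi.const_mul (C * (2 / ε)))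
    ?_).2.differentiableAt
  · exact (Complex.measurable_ofReal.comp (Real.measurable_log.comp
      (continuous_symplecticForm η).abs.measurable)).aestronglyMeasurable.mul
      (aestronglyMeasurable_gaussianIntegrand η q s₀ δ)
  · filter_upwards [ae_symplecticForm_ne_zero hη] with x hx s h
    have hx' : 0 < |symplecticForm n x η| := abs_pos.2 hx
    rw [gaussianIntegrand, norm_mul, norm_mul, norm_mul, Complex.norm_real, Complex.norm_real,
      Real.norm_of_nonneg (Real.exp_pos _).le, Real.norm_eq_abs]
    set T := |symplecticForm n x η| with hT
    calc _ ≤ |Real.log T| * (‖evalAt q x‖ * T ^ s.re *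
            Real.exp (-‖x‖ ^ 2)) := by
          gcongr
          exact norm_signedPow_le _ _ _
      _ = (‖evalAt q x‖ * Real.exp (-‖x‖ ^ 2)) *
            (|Real.log T| * T ^ s.re) := by ring
      _ ≤ (C * Real.exp (-(1 / 2) * ‖x‖ ^ 2)) * (2 / ε * (T ^ (s₀.re - 2 * ε) +
            T ^ (s₀.re + 2 * ε))) :=
          mul_le_mul (hC x) (abs_log_mul_rpow_le hx' hε0 (hmem s h)) (by positivity)
            (by positivity)
      _ = _ := by
          simp only [Pi.add_apply]
          ring
  · filter_upwards [ae_symplecticForm_ne_zero hη] with x hx s _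
    have := ((hasDerivAt_signedPow_exponent hx δ s).const_mul (evalAt q x)).mul_const
      (Real.exp (-‖x‖ ^ 2) : ℂ)
    refine this.congr_deriv ?_
    rw [gaussianIntegrand]
    ring

/-- Both sides are analytic on the half plane `Re s > -1` and agree near `k + 1`, where
`gaussianIntegral_eq_of_lt_re` applies. -/
theorem gaussianIntegral_eq (hn : 1 ≤ n) (hη : η ≠ 0) {k : ℕ}
    {q : MvPolynomial (Fin n ⊕ Fin n) ℂ} (hk : q.IsHomogeneous k)
    (hq : complexLaplacian n q = 0) {s : ℂ} (hs : -1 < s.re) :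
    gaussianIntegral η q s (k : ZMod 2) = evalAt q (-Complex.I • η) *
        ((Real.sqrt Real.pi : ℂ) ^ (2 * n - 1) * (‖η‖ : ℂ) ^ (s - k) *
          (Complex.Gamma ((s + 1) / 2) * Complex.Gamma (s / 2 + 1) /
            Complex.Gamma ((s - k) / 2 + 1))) := by
  have hU : IsOpen {s : ℂ | -1 < s.re} := isOpen_lt continuous_const Complex.continuous_re
  have hk0 : (0 : ℝ) ≤ k := k.cast_nonneg
  have hη0 : (‖η‖ : ℂ) ≠ 0 := by simpa using hη
  have ha : AnalyticOnNhd ℂ (fun s => gaussianIntegral η q s (k : ZMod 2)) {s : ℂ | -1 < s.re} :=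
    DifferentiableOn.analyticOnNhd (fun s hs =>
      (differentiableAt_gaussianIntegral hn hη q _ hs).differentiableWithinAt) hU
  refine ha.eqOn_of_preconnected_of_eventuallyEq (z₀ := ((k + 1 : ℝ) : ℂ))
    (g := fun s : ℂ => evalAt q (-Complex.I • η) *
        ((Real.sqrt Real.pi : ℂ) ^ (2 * n - 1) * (‖η‖ : ℂ) ^ (s - k) *
          (Complex.Gamma ((s + 1) / 2) * Complex.Gamma (s / 2 + 1) /
            Complex.Gamma ((s - k) / 2 + 1))))
    (DifferentiableOn.analyticOnNhd (fun s hs => ?_) hU)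
    (convex_halfSpace_re_gt (-1)).isPreconnected (by simp; linarith) ?_ hs
  · have hs' : -1 < s.re := hs
    refine DifferentiableAt.differentiableWithinAt ?_
    have h1 : DifferentiableAt ℂ (fun s : ℂ => Complex.Gamma ((s + 1) / 2)) s :=
      (differentiableAt_Gamma_of_re_pos (by simp; linarith)).comp s (by fun_prop)
    have h2 : DifferentiableAt ℂ (fun s : ℂ => Complex.Gamma (s / 2 + 1)) s :=
      (differentiableAt_Gamma_of_re_pos (by simp; linarith)).comp s (by fun_prop)
    -- This argument may meet poles of `Γ`. There `Complex.Gamma` has the value `0`, with inverse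
    -- `0`, so the inverse is the entire function `1/Γ`.
    have h3 : DifferentiableAt ℂ (fun s : ℂ => (Complex.Gamma ((s - k) / 2 + 1))⁻¹) s :=
      (Complex.differentiable_one_div_Gamma _).comp s
        (f := fun s : ℂ => (s - k) / 2 + 1) (by fun_prop)
    have h4 : DifferentiableAt ℂ (fun s : ℂ => (‖η‖ : ℂ) ^ (s - k)) s :=
      DifferentiableAt.const_cpow (by fun_prop) (Or.inl hη0)
    simp only [div_eq_mul_inv _ (Complex.Gamma ((_ - _) / _ + _))]
    exact (differentiableAt_const _).mul (((differentiableAt_const _).mul h4).mul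
      ((h1.mul h2).mul h3))
  · have : {s : ℂ | (k : ℝ) < s.re} ∈ nhds (((k + 1 : ℝ)) : ℂ) :=
      (isOpen_lt continuous_const Complex.continuous_re).mem_nhds (by simp)
    filter_upwards [this] with s hs
    exact gaussianIntegral_eq_of_lt_re hn hη k hs hk hq

end Exponent

/-! ### Polar coordinates -/

theorem integral_polar {E : Type*} [NormedAddCommGroup E] [NormedSpace ℝ E] [MeasurableSpace E]
    [BorelSpace E] [FiniteDimensional ℝ E] [Nontrivial E] (μ : Measure E) [μ.IsAddHaarMeasure]
    (f : sphere (0 : E) 1 → ℂ) (g : ℝ → ℂ) (F : E → ℂ)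
    (hF : ∀ (ξ : sphere (0 : E) 1) (r : ℝ), 0 < r → F (r • (ξ : E)) = f ξ * g r) :
    ∫ x, F x ∂μ = (∫ ξ, f ξ ∂μ.toSphere) *
      ∫ r in Ioi (0 : ℝ), (r : ℂ) ^ (Module.finrank ℝ E - 1) * g r := by
  calc ∫ x, F x ∂μ = ∫ x : ({0}ᶜ : Set E), F x ∂(μ.comap (↑)) := by
        rw [integral_subtype_comap (measurableSet_singleton _).compl F, restrict_compl_singleton]
    _ = ∫ x, f x.1 * g x.2 ∂μ.toSphere.prod (.volumeIoiPow (Module.finrank ℝ E - 1)) := by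
        rw [← μ.measurePreserving_homeomorphUnitSphereProd.integral_comp
          (Homeomorph.measurableEmbedding _) (fun x => f x.1 * g x.2)]
        congr 1 with x
        rw [← hF _ _ (homeomorphUnitSphereProd E x).2.2, ← homeomorphUnitSphereProd_symm_apply_coe,
          Homeomorph.symm_apply_apply]
    _ = (∫ ξ, f ξ ∂μ.toSphere) *
          ∫ r : Ioi (0 : ℝ), g r ∂.volumeIoiPow (Module.finrank ℝ E - 1) :=
        integral_prod_mul f (fun r : Ioi (0 : ℝ) => g r)
    _ = _ := by
        congr 1
        simp only [Measure.volumeIoiPow, ENNReal.ofReal]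
        rw [integral_withDensity_eq_integral_smul
          (measurable_subtype_coe.pow_const _).real_toNNReal, integral_subtype_comap
          measurableSet_Ioi fun a : ℝ => Real.toNNReal (a ^ (Module.finrank ℝ E - 1)) • g a]
        refine setIntegral_congr_fun measurableSet_Ioi fun x hx => ?_
        simp only [NNReal.smul_def, Real.coe_toNNReal _ (pow_nonneg (le_of_lt (mem_Ioi.1 hx)) _)]
        simp

section PolarCoordinates

variable {n : ℕ} {η : Cn n}

/-- The integrand without its Gaussian is homogeneous of degree `α + β + s`, and the volume element
contributes `r^(2n-1)`; the radial integral is the Gamma factor. -/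
theorem gaussianIntegral_eq_mul_knappSteinIntegral (hn : 1 ≤ n) {α β : ℕ}
    (p : harmonics n α β) {s : ℂ} (hs : -1 < s.re) (δ : ZMod 2) :
    gaussianIntegral η p.1 s δ = knappSteinIntegral n (-s - n) δ (evalAt p.1) η *
      (1 / 2 * Complex.Gamma (((α + β : ℕ) + s + 2 * n) / 2)) := by
  have : Nonempty (Fin n) := ⟨⟨0, hn⟩⟩
  have h := integral_polar (volume : Measure (Cn n))
    (fun ξ => evalAt p.1 ξ * ((|symplecticForm n ξ η| : ℝ) : ℂ) ^ s *
      sgnPow (symplecticForm n ξ η) δ)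
    (fun r => (r : ℂ) ^ (α + β) * (r : ℂ) ^ s * Complex.exp (-(r : ℂ) ^ 2))
    (gaussianIntegrand η p.1 s δ) (fun ξ r hr => by
      have h1 : symplecticForm n (r • (ξ : Cn n)) η = r * symplecticForm n ξ η := by
        simp only [symplecticForm_eq_inner, real_inner_smul_right]
      have h2 : ‖r • (ξ : Cn n)‖ = r := by
        rw [norm_smul, norm_eq_of_mem_sphere, mul_one, Real.norm_of_nonneg hr.le]
      rw [gaussianIntegrand, evalAt_smul p.2, h1, h2, signedPow_mul_of_pos hr, signedPow]
      push_cast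
      ring)
  have hg : ∫ r in Ioi (0 : ℝ), (r : ℂ) ^ (Module.finrank ℝ (Cn n) - 1) *
      ((r : ℂ) ^ (α + β) * (r : ℂ) ^ s * Complex.exp (-(r : ℂ) ^ 2)) =
      1 / 2 * Complex.Gamma (((α + β : ℕ) + s + 2 * n) / 2) := by
    have hre : -1 < ((α + β : ℕ) + s + (2 * n - 1 : ℕ) : ℂ).re := by
      have h1 : (0 : ℝ) ≤ ((α + β : ℕ) : ℝ) := Nat.cast_nonneg _
      have h2 : (0 : ℝ) ≤ ((2 * n - 1 : ℕ) : ℝ) := Nat.cast_nonneg _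
      rw [Complex.add_re, Complex.add_re, Complex.natCast_re, Complex.natCast_re]
      linarith
    have e : (((α + β : ℕ) : ℂ) + s + 2 * n) / 2
        = ((α + β : ℕ) + s + (2 * n - 1 : ℕ) + 1 : ℂ) / 2 := by
      rw [Nat.cast_sub (by omega : 1 ≤ 2 * n)]
      push_cast
      ring
    rw [e, ← integral_Ioi_cpow_mul_exp_neg_sq hre, finrank_Cn]
    refine setIntegral_congr_fun measurableSet_Ioi fun r hr => ?_
    have hr0 : (r : ℂ) ≠ 0 := Complex.ofReal_ne_zero.2 (ne_of_gt hr)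
    simp only [Complex.cpow_add _ _ hr0, Complex.cpow_natCast]
    ring
  rw [gaussianIntegral, h, hg, knappSteinIntegral]
  congr 2 with ξ
  rw [show -(-s - (n : ℂ)) - n = s by ring]

/-- Each `z_i` is multiplied by `-i` and each `z̄_i` by `i = (-i)(-1)`. This is the origin of the
sign `(-1)^β`. -/
theorem evalAt_neg_I_smul {α β : ℕ} (p : harmonics n α β) (z : Cn n) :
    evalAt p.1 (-Complex.I • z) = (-Complex.I) ^ (α + β) * (-1) ^ β * evalAt p.1 z := by
  obtain ⟨⟨h1, h2⟩, -⟩ := p.2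
  simp only [evalAt, MvPolynomial.eval_eq', Finset.mul_sum]
  refine Finset.sum_congr rfl fun d hd => ?_
  rw [MvPolynomial.mem_support_iff] at hd
  have e1 := h1 hd
  have e2 := h2 hd
  simp only [Finsupp.weight_apply, Finsupp.sum_fintype, Fintype.sum_sum_type, Sum.elim_inl,
    Sum.elim_inr, smul_eq_mul, mul_one, mul_zero, Finset.sum_const_zero, add_zero, zero_add,
    zero_mul, implies_true] at e1 e2
  simp only [Fintype.prod_sum_type, Sum.elim_inl, Sum.elim_inr, PiLp.smul_apply, smul_eq_mul,
    map_mul, mul_pow, Finset.prod_mul_distrib, Finset.prod_pow_eq_pow_sum, e1, e2, pow_add]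
  have : (starRingEnd ℂ (-Complex.I)) ^ β = (-Complex.I) ^ β * (-1) ^ β := by
    rw [← mul_pow]
    simp
  rw [this]
  ring

theorem isHomogeneous_of_mem_harmonics {α β : ℕ} {p : MvPolynomial (Fin n ⊕ Fin n) ℂ}
    (hp : p ∈ harmonics n α β) : p.IsHomogeneous (α + β) := by
  obtain ⟨⟨h1, h2⟩, -⟩ := hp
  intro d hd
  have e1 := h1 hd
  have e2 := h2 hd
  simp only [Finsupp.weight_apply, Finsupp.sum_fintype, Fintype.sum_sum_type, Sum.elim_inl,
    Sum.elim_inr, smul_eq_mul, mul_one, mul_zero, Finset.sum_const_zero, add_zero, zero_add,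
    zero_mul, implies_true, Pi.one_apply] at e1 e2 ⊢
  rw [e1, e2]

/-- The explicit form of the meromorphic continuation, with `s = -μ - n`. -/
def eigenvalue (n k : ℕ) (s : ℂ) : ℂ :=
  2 * (Real.sqrt Real.pi : ℂ) ^ (2 * n - 1) * (-Complex.I) ^ k *
    (Complex.Gamma ((s + 1) / 2) * Complex.Gamma (s / 2 + 1) /
      (Complex.Gamma ((s - k) / 2 + 1) * Complex.Gamma ((k + s + 2 * n) / 2)))

theorem knappSteinIntegral_eq (hn : 1 ≤ n) (hη : η ≠ 0) {α β : ℕ} (p : harmonics n α β) {μ : ℂ}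
    (hμ : μ ∈ convergenceDomain n) :
    knappSteinIntegral n μ ((α + β : ℕ) : ZMod 2) (evalAt p.1) η =
      (-1) ^ β * eigenvalue n (α + β) (-μ - n) * homExt n μ p.1 η := by
  have hμ' : μ.re < 1 - n := hμ
  have hs : -1 < (-μ - n : ℂ).re := by simp; linarith
  have hΓ : Complex.Gamma (((α + β : ℕ) + (-μ - n) + 2 * n) / 2) ≠ 0 := by
    refine Complex.Gamma_ne_zero_of_re_pos ?_
    have h1 : (0 : ℝ) ≤ ((α + β : ℕ) : ℝ) := Nat.cast_nonneg _
    have h2 : (1 : ℝ) ≤ n := by exact_mod_cast hn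
    have : (((α + β : ℕ) + (-μ - n) + 2 * n) / 2 : ℂ).re
        = ((α + β : ℕ) + (-μ.re - n) + 2 * n : ℝ) / 2 := by
      rw [Complex.div_ofNat_re]
      simp
    rw [this]
    linarith
  have h := gaussianIntegral_eq_mul_knappSteinIntegral (η := η) hn p hs ((α + β : ℕ) : ZMod 2)
  have hη0 : (‖η‖ : ℂ) ≠ 0 := by simpa using hη
  rw [show -(-μ - (n : ℂ)) - n = μ by ring, gaussianIntegral_eq hn hη
    (isHomogeneous_of_mem_harmonics p.2) (LinearMap.mem_ker.1 p.2.2) hs, evalAt_neg_I_smul] at h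
  -- With `k = α + β`, the power `‖η‖^(-n-μ)` is split as `‖η‖^(s-k) ‖η‖^k`; the second factor
  -- cancels the `‖η‖^(-k)` from evaluating `p` at `η / ‖η‖`.
  rw [homExt, if_neg hη, evalAt_smul p.2, eigenvalue,
    show -(n : ℂ) - μ = (-μ - n - (α + β : ℕ)) + (α + β : ℕ) by ring, Complex.cpow_add _ _ hη0,
    Complex.cpow_natCast]
  have e : ((‖η‖⁻¹ : ℝ) : ℂ) ^ (α + β) * (‖η‖ : ℂ) ^ (α + β) = 1 := by
    rw [← mul_pow, Complex.ofReal_inv, inv_mul_cancel₀ hη0, one_pow]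
  have e2 : knappSteinIntegral n μ ((α + β : ℕ) : ZMod 2) (evalAt p.1) η =
      2 * (knappSteinIntegral n μ ((α + β : ℕ) : ZMod 2) (evalAt p.1) η *
      (1 / 2 * Complex.Gamma (((α + β : ℕ) + (-μ - n) + 2 * n) / 2))) /
        Complex.Gamma (((α + β : ℕ) + (-μ - n) + 2 * n) / 2) := by
    field_simp
  rw [e2, ← h]
  simp only [div_eq_mul_inv, mul_inv]
  linear_combination -(2 * ((-Complex.I) ^ (α + β) * (-1) ^ β * evalAt p.1 η *
    ((Real.sqrt Real.pi : ℂ) ^ (2 * n - 1) * (‖η‖ : ℂ) ^ (-μ - n - (α + β : ℕ)) *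
      (Complex.Gamma ((-μ - n + 1) * 2⁻¹) * Complex.Gamma ((-μ - n) * 2⁻¹ + 1) *
        (Complex.Gamma ((-μ - n - (α + β : ℕ)) * 2⁻¹ + 1))⁻¹))) *
    (Complex.Gamma (((α + β : ℕ) + (-μ - n) + 2 * n) * 2⁻¹))⁻¹) * e

end PolarCoordinates

/-! ### Meromorphic continuation -/

/-- The difference has infinite order at a point of `U`, hence everywhere because `ℂ` is connected.
Normal forms that agree on punctured neighbourhoods agree at the centre too, poles included. -/
theorem IsMeromorphicContinuation.unique {g F G : ℂ → ℂ} {U : Set ℂ} (hU : IsOpen U)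
    (hne : U.Nonempty) (hF : IsMeromorphicContinuation g U F)
    (hG : IsMeromorphicContinuation g U G) : F = G := by
  obtain ⟨z, hz⟩ := hne
  have hm : MeromorphicOn (F - G) univ := hF.1.meromorphicOn.sub hG.1.meromorphicOn
  have hz0 : meromorphicOrderAt (F - G) z = ⊤ := by
    rw [meromorphicOrderAt_eq_top_iff]
    refine Filter.Eventually.filter_mono nhdsWithin_le_nhds ?_
    filter_upwards [hU.mem_nhds hz] with w hw
    rw [Pi.sub_apply, hF.2 hw, hG.2 hw, sub_self]
  funext w
  have hw : meromorphicOrderAt (F - G) w = ⊤ := by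
    by_contra h
    exact hm.meromorphicOrderAt_ne_top_of_isPreconnected isPreconnected_univ (mem_univ w)
      (mem_univ z) h hz0
  rw [meromorphicOrderAt_eq_top_iff] at hw
  refine ((MeromorphicNFAt.eventuallyEq_nhdsNE_iff_eventuallyEq_nhds (hF.1 (mem_univ w))
    (hG.1 (mem_univ w))).1 ?_).eq_of_nhds
  filter_upwards [hw] with v hv
  exact sub_eq_zero.1 hv

theorem meromorphicContinuation_eq {g F : ℂ → ℂ} {U : Set ℂ} (hU : IsOpen U)
    (hne : U.Nonempty) (hF : IsMeromorphicContinuation g U F) :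
    meromorphicContinuation g U = F := by
  have h : ∃ F, IsMeromorphicContinuation g U F := ⟨F, hF⟩
  rw [meromorphicContinuation, dif_pos h]
  exact h.choose_spec.unique hU hne hF

theorem toMeromorphicNFOn_univ_eq {f g : ℂ → ℂ} (hf : MeromorphicOn f univ) {z : ℂ}
    (hg : AnalyticAt ℂ g z) (h : f =ᶠ[nhdsWithin z {z}ᶜ] g) :
    toMeromorphicNFOn f univ z = g z := by
  rw [toMeromorphicNFOn_eq_toMeromorphicNFAt hf (mem_univ z),
    (toMeromorphicNFAt_eventuallyEq_nhds_congr h).eq_of_nhds,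
    toMeromorphicNFAt_eq_self.2 hg.meromorphicNFAt]

theorem isMeromorphicContinuation_toMeromorphicNFOn {f g : ℂ → ℂ} {U : Set ℂ}
    (hf : MeromorphicOn f univ) (ha : ∀ z ∈ U, AnalyticAt ℂ f z) (h : EqOn f g U) :
    IsMeromorphicContinuation g U (toMeromorphicNFOn f univ) :=
  ⟨meromorphicNFOn_toMeromorphicNFOn f univ, fun z hz => by
    rw [toMeromorphicNFOn_univ_eq hf (ha z hz) Filter.EventuallyEq.rfl, h hz]⟩

theorem meromorphicAt_Gamma_comp {f : ℂ → ℂ} {z : ℂ} (hf : AnalyticAt ℂ f z) :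
    MeromorphicAt (fun w => Complex.Gamma (f w)) z :=
  MeromorphicAt.comp_analyticAt (Meromorphic.Gamma (f z)) hf

section Eigenvalue

variable {n : ℕ} {η : Cn n}

theorem analyticAt_homExt (hη : η ≠ 0) (p : MvPolynomial (Fin n ⊕ Fin n) ℂ) (μ : ℂ) :
    AnalyticAt ℂ (fun ν => homExt n ν p η) μ := by
  simp only [homExt, if_neg hη]
  refine AnalyticAt.mul ?_ analyticAt_const
  have hη0 : (‖η‖ : ℂ) ≠ 0 := by simpa using hη
  have : Differentiable ℂ fun ν : ℂ => (‖η‖ : ℂ) ^ (-(n : ℂ) - ν) := fun ν =>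
    DifferentiableAt.const_cpow (by fun_prop) (Or.inl hη0)
  exact this.analyticAt μ

theorem meromorphicAt_eigenvalue (n k : ℕ) (s : ℂ) : MeromorphicAt (eigenvalue n k) s := by
  refine (MeromorphicAt.const _ _).fun_mul (MeromorphicAt.fun_div
    ((meromorphicAt_Gamma_comp ?_).fun_mul (meromorphicAt_Gamma_comp ?_))
    ((meromorphicAt_Gamma_comp ?_).fun_mul (meromorphicAt_Gamma_comp ?_))) <;> fun_prop

theorem differentiableAt_eigenvalue (n k : ℕ) {s : ℂ}
    (h1 : ∀ m : ℕ, (s + 1) / 2 ≠ -m) (h2 : ∀ m : ℕ, s / 2 + 1 ≠ -m) :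
    DifferentiableAt ℂ (eigenvalue n k) s := by
  have e1 : DifferentiableAt ℂ (fun s : ℂ => Complex.Gamma ((s + 1) / 2)) s :=
    (Complex.differentiableAt_Gamma _ h1).comp s (by fun_prop)
  have e2 : DifferentiableAt ℂ (fun s : ℂ => Complex.Gamma (s / 2 + 1)) s :=
    (Complex.differentiableAt_Gamma _ h2).comp s (by fun_prop)
  have e3 : DifferentiableAt ℂ (fun s : ℂ => (Complex.Gamma ((s - k) / 2 + 1))⁻¹) s :=
    (Complex.differentiable_one_div_Gamma _).comp s
      (f := fun s : ℂ => (s - k) / 2 + 1) (by fun_prop)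
  have e4 : DifferentiableAt ℂ (fun s : ℂ => (Complex.Gamma ((k + s + 2 * n) / 2))⁻¹) s :=
    (Complex.differentiable_one_div_Gamma _).comp s
      (f := fun s : ℂ => (k + s + 2 * n) / 2) (by fun_prop)
  have e : eigenvalue n k = fun s =>
      2 * (Real.sqrt Real.pi : ℂ) ^ (2 * n - 1) * (-Complex.I) ^ k *
      (Complex.Gamma ((s + 1) / 2) * Complex.Gamma (s / 2 + 1) *
      ((Complex.Gamma ((s - k) / 2 + 1))⁻¹ * (Complex.Gamma ((k + s + 2 * n) / 2))⁻¹)) := by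
    funext s
    rw [eigenvalue, div_eq_mul_inv, mul_inv]
  rw [e]
  exact (differentiableAt_const _).mul ((e1.mul e2).mul (e3.mul e4))

/-- The explicit form of the Knapp–Stein integral of `p` at `η`. -/
def explicitIntegral (n α β : ℕ) (p : MvPolynomial (Fin n ⊕ Fin n) ℂ) (η : Cn n) (μ : ℂ) : ℂ :=
  (-1) ^ β * eigenvalue n (α + β) (-μ - n) * homExt n μ p η

theorem meromorphicAt_explicitIntegral (hη : η ≠ 0) (α β : ℕ)
    (p : MvPolynomial (Fin n ⊕ Fin n) ℂ) (μ : ℂ) :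
    MeromorphicAt (explicitIntegral n α β p η) μ := by
  refine MeromorphicAt.fun_mul (MeromorphicAt.fun_mul (MeromorphicAt.const _ _) ?_)
    (analyticAt_homExt hη p μ).meromorphicAt
  exact MeromorphicAt.comp_analyticAt (g := fun μ : ℂ => -μ - n)
    (meromorphicAt_eigenvalue n _ _) (by fun_prop)

theorem analyticAt_explicitIntegral (hη : η ≠ 0) (α β : ℕ)
    (p : MvPolynomial (Fin n ⊕ Fin n) ℂ) {μ : ℂ} (h1 : ∀ m : ℕ, (-μ - n + 1) / 2 ≠ -m)
    (h2 : ∀ m : ℕ, (-μ - n) / 2 + 1 ≠ -m) :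
    AnalyticAt ℂ (explicitIntegral n α β p η) μ := by
  refine (meromorphicAt_explicitIntegral hη α β p μ).analyticAt (DifferentiableAt.continuousAt
    (𝕜 := ℂ) (((differentiableAt_const _).mul ?_).mul (analyticAt_homExt hη p μ).differentiableAt))
  exact (differentiableAt_eigenvalue n (α + β) h1 h2).comp μ (f := fun μ : ℂ => -μ - n)
    (by fun_prop)

theorem ne_neg_natCast_of_re_pos {z : ℂ} (hz : 0 < z.re) (m : ℕ) : z ≠ -m := by
  rintro rfl
  simp at hz
  linarith [(m.cast_nonneg : (0 : ℝ) ≤ m)]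

/-- On the half plane of convergence both Gamma factors in the numerator of `eigenvalue` have
arguments of positive real part, so passing to the normal form changes no value there. -/
theorem isMeromorphicContinuation_explicitIntegral (hn : 1 ≤ n) (hη : η ≠ 0) {α β : ℕ}
    (p : harmonics n α β) :
    IsMeromorphicContinuation
      (fun μ => knappSteinIntegral n μ ((α + β : ℕ) : ZMod 2) (evalAt p.1) η)
      (convergenceDomain n) (toMeromorphicNFOn (explicitIntegral n α β p.1 η) univ) := by
  refine isMeromorphicContinuation_toMeromorphicNFOn
    (fun μ _ => meromorphicAt_explicitIntegral hη α β p.1 μ) (fun μ hμ => ?_)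
    (fun μ hμ => (knappSteinIntegral_eq hn hη p hμ).symm)
  have hμ' : μ.re < 1 - n := hμ
  exact analyticAt_explicitIntegral hη α β p.1
    (ne_neg_natCast_of_re_pos (by simp; linarith))
    (ne_neg_natCast_of_re_pos (by simp; linarith))

theorem isOpen_convergenceDomain (n : ℕ) : IsOpen (convergenceDomain n) :=
  isOpen_lt Complex.continuous_re continuous_const

theorem nonempty_convergenceDomain (n : ℕ) : (convergenceDomain n).Nonempty :=
  ⟨((-n : ℝ) : ℂ), by simp [convergenceDomain]⟩

theorem homExt_of_mem_sphere (μ : ℂ) (p : MvPolynomial (Fin n ⊕ Fin n) ℂ)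
    (ξ : sphere (0 : Cn n) 1) : homExt n μ p ξ = evalAt p ξ := by
  have h : ‖(ξ : Cn n)‖ = 1 := norm_eq_of_mem_sphere ξ
  have h0 : (ξ : Cn n) ≠ 0 := by
    rw [← norm_ne_zero_iff, h]
    exact one_ne_zero
  simp [homExt, h0, h]

/-- The integral sees `f` only on the sphere, where every `homExt n μ p` equals `p`. The parameter
`ν` of continuation is therefore independent of the degree `μ` of the extension. -/
theorem knappStein_kType (hn : 1 ≤ n) (hη : η ≠ 0) {α β : ℕ} (p : harmonics n α β) (μ ν : ℂ) :
    knappStein n ν ((α + β : ℕ) : ZMod 2) (kType n μ α β p : principalSeries n μ _) η =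
      toMeromorphicNFOn (explicitIntegral n α β p.1 η) univ ν := by
  rw [knappStein, if_neg hη]
  have e : (fun ν => knappSteinIntegral n ν ((α + β : ℕ) : ZMod 2)
      ((kType n μ α β p : principalSeries n μ _) : Cn n → ℂ) η) =
      fun ν => knappSteinIntegral n ν ((α + β : ℕ) : ZMod 2) (evalAt p.1) η := by
    funext ν
    simp only [knappSteinIntegral]
    congr 1 with ξ
    rw [← homExt_of_mem_sphere μ p.1 ξ]
    rfl
  rw [e, meromorphicContinuation_eq (isOpen_convergenceDomain n) (nonempty_convergenceDomain n)
    (isMeromorphicContinuation_explicitIntegral hn hη p)]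

end Eigenvalue

/-! ### The normalized eigenvalue -/

/-- By the reflection formula the product is `π / sin(πz)`, and each unit shift changes the sign of
the sine. -/
theorem Gamma_mul_Gamma_one_sub_add_nat (z : ℂ) (m : ℕ) :
    Complex.Gamma (z + m) * Complex.Gamma (1 - (z + m))
      = (-1) ^ m * (Complex.Gamma z * Complex.Gamma (1 - z)) := by
  induction m with
  | zero => simp
  | succ m ih =>
    rw [pow_succ, mul_comm _ (-1 : ℂ), mul_assoc, ← ih, Complex.Gamma_mul_Gamma_one_sub,
      Complex.Gamma_mul_Gamma_one_sub]
    have : (Real.pi : ℂ) * (z + (m + 1 : ℕ)) = Real.pi * (z + m) + Real.pi := by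
      push_cast; ring
    rw [this, Complex.sin_add_pi, div_neg, neg_one_mul]

/-- Since `Complex.Gamma` is `0` at its poles, nonvanishing means avoiding them. Every argument that
occurs is half of `±ν` plus an integer. -/
theorem Gamma_ne_zero_of_two_mul_add {ν z : ℂ} (hν : ∀ m : ℤ, ν ≠ m) (a : ℤ)
    (h : 2 * z = ν + a ∨ 2 * z = -ν + a) : Complex.Gamma z ≠ 0 := by
  refine Complex.Gamma_ne_zero fun m hm => ?_
  subst hm
  rcases h with h | h
  · refine hν (-2 * m - a) ?_
    push_cast
    linear_combination -h
  · refine hν (2 * m + a) ?_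
    push_cast
    linear_combination h

theorem sqrt_pi_pow_mul_cpow {n : ℕ} (hn : 1 ≤ n) (ν : ℂ) :
    (Real.sqrt Real.pi : ℂ) ^ (2 * n - 1)
      = (Real.pi : ℂ) ^ (-ν) * (Real.pi : ℂ) ^ (ν + n - 1 / 2) := by
  have hpi : (Real.pi : ℂ) ≠ 0 := Complex.ofReal_ne_zero.2 Real.pi_ne_zero
  have h : (Real.sqrt Real.pi : ℂ) = (Real.pi : ℂ) ^ (1 / 2 : ℂ) := by
    rw [Real.sqrt_eq_rpow, Complex.ofReal_cpow Real.pi_pos.le]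
    norm_num
  rw [h, ← Complex.cpow_nat_mul, ← Complex.cpow_add _ _ hpi, Nat.cast_sub (by omega)]
  congr 1
  push_cast
  ring

/-- The scalar by which the normalized operator acts, up to the sign `(-1) ^ β`. -/
def normalizedEigenvalue (n k : ℕ) (μ : ℂ) : ℂ :=
  (Real.pi : ℂ) ^ (-μ) * (Complex.Gamma ((k + μ + n) / 2) / Complex.Gamma ((k - μ + n) / 2))

/-- One of the two Gamma factors in the numerator of `eigenvalue` cancels against the normalization,
which one depending on the parity of `k`. The other is moved by the reflection formula, whose sign
cancels the one in `(-i)^k`. Off the integers all divisions are genuine. -/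
theorem inv_normalization_mul_eigenvalue {n : ℕ} (hn : 1 ≤ n) (k : ℕ) {ν : ℂ}
    (hν : ∀ m : ℤ, ν ≠ m) :
    (normalization n ν (k : ZMod 2))⁻¹ * eigenvalue n k (-ν - n) = normalizedEigenvalue n k ν := by
  have hpi : (Real.pi : ℂ) ≠ 0 := Complex.ofReal_ne_zero.2 Real.pi_ne_zero
  have hP : (Real.pi : ℂ) ^ (ν + n - 1 / 2) ≠ 0 := by simp [Complex.cpow_eq_zero_iff, hpi]
  have g1 : Complex.Gamma ((-ν - n + 1) / 2) ≠ 0 :=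
    Gamma_ne_zero_of_two_mul_add hν (-n + 1) (Or.inr (by push_cast; ring))
  have g2 : Complex.Gamma ((-ν - n) / 2 + 1) ≠ 0 :=
    Gamma_ne_zero_of_two_mul_add hν (-n + 2) (Or.inr (by push_cast; ring))
  have g3 : Complex.Gamma ((-ν - n - k) / 2 + 1) ≠ 0 :=
    Gamma_ne_zero_of_two_mul_add hν (-n - k + 2) (Or.inr (by push_cast; ring))
  have g4 : Complex.Gamma ((k - ν + n) / 2) ≠ 0 :=
    Gamma_ne_zero_of_two_mul_add hν (k + n) (Or.inr (by push_cast; ring))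
  have g5 : Complex.Gamma ((ν + n) / 2) ≠ 0 :=
    Gamma_ne_zero_of_two_mul_add hν n (Or.inl (by push_cast; ring))
  have g6 : Complex.Gamma ((ν + n + 1) / 2) ≠ 0 :=
    Gamma_ne_zero_of_two_mul_add hν (n + 1) (Or.inl (by push_cast; ring))
  rw [eigenvalue, normalizedEigenvalue, sqrt_pi_pow_mul_cpow hn ν,
    show ((k : ℂ) + (-ν - n) + 2 * n) / 2 = (k - ν + n) / 2 by ring]
  rcases Nat.even_or_odd' k with ⟨m, hm | hm⟩
  · have hδ : (k : ZMod 2) = 0 := (ZMod.natCast_eq_zero_iff_even).2 ⟨m, by omega⟩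
    have hI : (-Complex.I) ^ k = (-1) ^ m := by
      rw [hm, pow_mul]
      simp
    have key := Gamma_mul_Gamma_one_sub_add_nat ((ν + n) / 2) m
    rw [show (ν + n) / 2 + m = (k + ν + n) / 2 by rw [hm]; push_cast; ring,
      show 1 - (k + ν + n) / 2 = (-ν - n - k) / 2 + 1 by ring,
      show 1 - (ν + n) / 2 = (-ν - n) / 2 + 1 by ring] at key
    rw [normalization, if_pos hδ, hI, show (1 - ν - n) / 2 = (-ν - n + 1) / 2 by ring]
    generalize Complex.Gamma ((-ν - n + 1) / 2) = G₁ at *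
    generalize Complex.Gamma ((-ν - n) / 2 + 1) = G₂ at *
    generalize Complex.Gamma ((-ν - n - k) / 2 + 1) = G₃ at *
    generalize Complex.Gamma ((k - ν + n) / 2) = G₄ at *
    generalize Complex.Gamma ((ν + n) / 2) = G₅ at *
    field_simp
    linear_combination -key
  · have hδ : (k : ZMod 2) ≠ 0 := fun h => by
      obtain ⟨j, hj⟩ := (ZMod.natCast_eq_zero_iff_even).1 h
      omega
    have hI : (-Complex.I) ^ k = (-1) ^ m * -Complex.I := by
      rw [hm, pow_succ, pow_mul]
      simp
    -- For `k = 2m + 1` the reflection starts half a unit further, and the extra `-i` in `(-i)^k`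
    -- matches the `-i` in the normalization.
    have key := Gamma_mul_Gamma_one_sub_add_nat ((ν + n + 1) / 2) m
    rw [show (ν + n + 1) / 2 + m = (k + ν + n) / 2 by rw [hm]; push_cast; ring,
      show 1 - (k + ν + n) / 2 = (-ν - n - k) / 2 + 1 by ring,
      show 1 - (ν + n + 1) / 2 = (-ν - n + 1) / 2 by ring] at key
    rw [normalization, if_neg hδ, hI, show (2 - ν - n) / 2 = (-ν - n) / 2 + 1 by ring]
    generalize Complex.Gamma ((-ν - n + 1) / 2) = G₁ at *
    generalize Complex.Gamma ((-ν - n) / 2 + 1) = G₂ at *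
    generalize Complex.Gamma ((-ν - n - k) / 2 + 1) = G₃ at *
    generalize Complex.Gamma ((k - ν + n) / 2) = G₄ at *
    generalize Complex.Gamma ((ν + n + 1) / 2) = G₅ at *
    field_simp
    linear_combination -key

theorem meromorphicAt_normalization (n : ℕ) (δ : ZMod 2) (μ : ℂ) :
    MeromorphicAt (fun ν => normalization n ν δ) μ := by
  have hpi : (Real.pi : ℂ) ≠ 0 := Complex.ofReal_ne_zero.2 Real.pi_ne_zero
  have hP : Differentiable ℂ fun ν : ℂ => 2 * (Real.pi : ℂ) ^ (ν + n - 1 / 2) := fun ν =>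
    (differentiableAt_const _).mul (DifferentiableAt.const_cpow (by fun_prop) (Or.inl hpi))
  refine MeromorphicAt.fun_mul (hP.analyticAt μ).meromorphicAt ?_
  by_cases hδ : δ = 0
  · simp only [if_pos hδ]
    refine MeromorphicAt.fun_div (meromorphicAt_Gamma_comp ?_) (meromorphicAt_Gamma_comp ?_) <;>
      fun_prop
  · simp only [if_neg hδ]
    refine (MeromorphicAt.const _ _).fun_mul (MeromorphicAt.fun_div (meromorphicAt_Gamma_comp ?_)
      (meromorphicAt_Gamma_comp ?_)) <;> fun_prop

/-- Only the numerator can have poles, since `1/Γ` is entire. -/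
theorem analyticAt_normalizedEigenvalue (n k : ℕ) {μ : ℂ}
    (hμ : ∀ j : ℕ, (k + μ + n) / 2 ≠ -j) :
    AnalyticAt ℂ (normalizedEigenvalue n k) μ := by
  have hpi : (Real.pi : ℂ) ≠ 0 := Complex.ofReal_ne_zero.2 Real.pi_ne_zero
  have hP : Differentiable ℂ fun ν : ℂ => (Real.pi : ℂ) ^ (-ν) := fun ν =>
    DifferentiableAt.const_cpow (by fun_prop) (Or.inl hpi)
  refine (hP.analyticAt μ).mul (MeromorphicAt.analyticAt (MeromorphicAt.fun_div
    (meromorphicAt_Gamma_comp (by fun_prop)) (meromorphicAt_Gamma_comp (by fun_prop)))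
    (DifferentiableAt.continuousAt (𝕜 := ℂ) ?_))
  have e1 : DifferentiableAt ℂ (fun ν : ℂ => Complex.Gamma ((k + ν + n) / 2)) μ :=
    (Complex.differentiableAt_Gamma _ hμ).comp μ (by fun_prop)
  have e2 : DifferentiableAt ℂ (fun ν : ℂ => (Complex.Gamma ((k - ν + n) / 2))⁻¹) μ :=
    (Complex.differentiable_one_div_Gamma _).comp μ (f := fun ν : ℂ => (k - ν + n) / 2)
      (by fun_prop)
  exact e1.mul e2

/-- The integers other than `μ` form a closed set; `μ` itself, integer or not, is removed by the
puncture. -/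
theorem eventually_ne_intCast (μ : ℂ) : ∀ᶠ ν : ℂ in nhdsWithin μ {μ}ᶜ, ∀ m : ℤ, ν ≠ m := by
  have h : IsClosed ((range ((↑) : ℤ → ℂ)) \ {μ}) := by
    have := Complex.isClosedEmbedding_intCast.isClosedMap (((↑) : ℤ → ℂ) ⁻¹' {μ}ᶜ)
      (isClosed_discrete _)
    rwa [image_preimage_eq_range_inter] at this
  filter_upwards [self_mem_nhdsWithin, nhdsWithin_le_nhds (h.isOpen_compl.mem_nhds
    (show μ ∈ (range ((↑) : ℤ → ℂ) \ {μ})ᶜ from fun h => h.2 rfl))] with ν h1 h2 m hm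
  exact h2 ⟨⟨m, hm.symm⟩, h1⟩

/-- The Gamma identity is available at non-integral `ν` only, but these fill a punctured
neighbourhood of `μ`. The claimed right side is analytic at `μ`, so `toMeromorphicNFOn_univ_eq`
gives the value there, even where the normalization or the operator is singular. -/
theorem normalizedKnappStein_kType {n : ℕ} (hn : 1 ≤ n) {α β : ℕ} (p : harmonics n α β) {μ : ℂ}
    (hμ : ∀ j : ℕ, ((α + β : ℕ) + μ + n) / 2 ≠ -j) {η : Cn n} (hη : η ≠ 0) :
    normalizedKnappStein n μ ((α + β : ℕ) : ZMod 2) (kType n (-μ) α β p) η =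
      (-1) ^ β * normalizedEigenvalue n (α + β) μ * homExt n μ p.1 η := by
  have hF := isMeromorphicContinuation_explicitIntegral hn hη p
  simp only [normalizedKnappStein, knappStein_kType hn hη p]
  refine toMeromorphicNFOn_univ_eq
    (g := fun ν => (-1) ^ β * normalizedEigenvalue n (α + β) ν * homExt n ν p.1 η)
    (fun ν _ => (meromorphicAt_normalization n _ ν).fun_inv.fun_mul (hF.1.meromorphicOn ν trivial))
    ((analyticAt_const.mul (analyticAt_normalizedEigenvalue n (α + β) hμ)).mul
      (analyticAt_homExt hη p.1 μ)) ?_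
  filter_upwards [eventually_ne_intCast μ] with ν hν
  have ha : AnalyticAt ℂ (explicitIntegral n α β p.1 η) ν := by
    refine analyticAt_explicitIntegral hη α β p.1 (fun m h => hν (2 * m - n + 1) ?_)
      (fun m h => hν (2 * m - n + 2) ?_)
    · push_cast
      linear_combination -2 * h
    · push_cast
      linear_combination -2 * h
  rw [toMeromorphicNFOn_univ_eq (fun ν _ => meromorphicAt_explicitIntegral hη α β p.1 ν) ha
    Filter.EventuallyEq.rfl, explicitIntegral, ← inv_normalization_mul_eigenvalue hn _ hν]
  ring

theorem normalizedKnappStein_zero (n : ℕ) (μ : ℂ) (δ : ZMod 2) (f : principalSeries n (-μ) δ) :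
    normalizedKnappStein n μ δ f 0 = 0 := by
  have e : (fun ν => (normalization n ν δ)⁻¹ * knappStein n ν δ f 0) = fun _ => 0 := by
    funext ν
    simp [knappStein]
  rw [normalizedKnappStein, e]
  exact toMeromorphicNFOn_univ_eq (g := fun _ => 0) (fun _ _ => MeromorphicAt.const _ _)
    analyticAt_const Filter.EventuallyEq.rfl

end KnappStein

end

theorem mainTheorem6 (n : ℕ) (hn : 1 ≤ n) (α β : ℕ) (p : KnappStein.harmonics n α β) :
    (∀ η : KnappStein.Cn n, η ≠ 0 → ∃ F : ℂ → ℂ,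
      KnappStein.IsMeromorphicContinuation
        (fun μ => KnappStein.knappSteinIntegral n μ ((α + β : ℕ) : ZMod 2)
          (KnappStein.evalAt p.1) η)
        (KnappStein.convergenceDomain n) F) ∧
    ∀ μ : ℂ, (∀ j : ℕ, (α : ℂ) + β + μ + n ≠ -(2 * j)) →
      KnappStein.normalizedKnappStein n μ ((α + β : ℕ) : ZMod 2)
          (KnappStein.kType n (-μ) α β p) =
        (((-1 : ℂ) ^ β * (Real.pi : ℂ) ^ (-μ) *
          (Complex.Gamma ((α + β + μ + n) / 2) / Complex.Gamma ((α + β - μ + n) / 2))) •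
          KnappStein.kType n μ α β p : KnappStein.principalSeries n μ ((α + β : ℕ) : ZMod 2)) := by
  refine ⟨fun η hη => ⟨_, KnappStein.isMeromorphicContinuation_explicitIntegral hn hη p⟩,
    fun μ hμ => ?_⟩
  funext η
  rw [Submodule.coe_smul, Pi.smul_apply, smul_eq_mul]
  change _ = _ * KnappStein.homExt n μ p.1 η
  -- At the origin both sides are `0` by the convention for extending functions from `ℝ²ⁿ ∖ {0}`.
  rcases eq_or_ne η 0 with rfl | hη
  · rw [KnappStein.normalizedKnappStein_zero, KnappStein.homExt, if_pos rfl, mul_zero]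
  · rw [KnappStein.normalizedKnappStein_kType hn p (fun j h => hμ j ?_) hη,
      KnappStein.normalizedEigenvalue]
    · push_cast
      ring
    · push_cast at h
      linear_combination 2 * h
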